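/- For $n\ge 0$ let $T_n$ be the number of ways to seat $n$ married couples (each consisting of a female and a male) on $2n$ labelled seats around a circular table so that no two spouses sit next to each other and no three consecutive persons have the same gender (so $T_0=1$, $T_1=0$). Let $$\begin{aligned} a(p,t) &= -2p^5t^3+2p^4t^4+4p^5t^2-8p^4t^3-2p^5t+12p^4t^2-8p^4t+6p^3t-4p^2t^2+16p^2-10pt+20p+6,\\ b(p,t) &= -p^2t(2+p-t)(p-3t+6),\\ c(p,t) &= p^6t^2-2p^5t^3+p^4t^4+4p^5t^2-4p^4t^3-2p^5t+6p^4t^2-4p^4t+2p^3t-p^2t^2+4p^2-2pt+4p+1,\\ d(p,t) &= -p^2t(2+p-t)^2 . \end{aligned}$$ (1) For all $n>1$, $$T_n = n!\int_0^\infty [p^n]\left(\frac{a(p,t)d(p,t)-b(p,t)c(p,t)}{d(p,t)\sqrt{c(p,t)^2-4p^2d(p,t)^2}}+\frac{b(p,t)}{d(p,t)}\right)e^{-t}\,dt ,$$ where for each fixed $t>0$ the expression in parentheses is a formal Laurent series in $p$, the square root being the formal power series with constant term $1$; the integral converges absolutely. (2) Put $$\begin{aligned} N(x,t) &= t^3x^2+(-2x^3-4x^2-x)t^2+(x^4+4x^3+7x^2+4x+3)t-6x^2-9x-6,\\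 D(x,t) &= (t^2x^2-tx^3-2tx^2-3xt+4x^2+4x+1)(t^2x^2-tx^3-2tx^2+xt+1). \end{aligned}$$ The exponential generating function of $T_n$ is $$\sum_{n\ge 0}T_n\frac{x^n}{n!} = -2+2x-2x\,e^{-x-2}\,\mathrm{Ei}(x+2)+\int_0^\infty\frac{N(x,t)\,e^{-t}}{(t-(x+2))\sqrt{D(x,t)}}\,dt ,$$ where $\mathrm{Ei}(s)=-\mathrm{PV}\!\int_{-s}^\infty \frac{e^{-u}}{u}\,du$. As the left-hand side is only a formal power series (its radius of convergence is $0$), and as the integrand on the right has a pole at $t=x+2$, this identity is understood in both of the following senses. (2a) Formally, with $-2x\,e^{-x-2}\mathrm{Ei}(x+2)$ replaced by the integral $-\int_0^\infty\frac{2x}{x+2-t}e^{-t}dt$ that it stands for, and with integration coefficient by coefficient: for every $n\ge 0$, $$\frac{T_n}{n!}=[x^n](-2+2x)+\int_0^\infty [x^n]\left(\frac{N(x,t)}{(t-(x+2))\sqrt{D(x,t)}}-\frac{2x}{x+2-t}\right)e^{-t}\,dt ,$$ where for each fixed $t>0$ the expression in parentheses is a formal Laurent series in $x$, $\sqrt{D}$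 being the formal power series with constant term $1$; the integral converges absolutely. (2b) Analytically: for all real $x$ sufficiently close to $0$, the principal value at $t=x+2$ of $\int_0^\infty\frac{e^{-t}}{x+2-t}dt$ exists and equals $e^{-x-2}\mathrm{Ei}(x+2)$, and the principal value at $t=x+2$ of the integral on the right-hand side exists (with the principal complex square root where $D(x,t)<0$); and, with this principal value, the right-hand side $R(x)$ has the left-hand side as its asymptotic expansion at $0$ to all orders: for every integer $m\ge0$, $$R(x)-\sum_{n<m}T_n\frac{x^n}{n!}=O(x^m)\qquad (x\to 0,\ x\in\mathbb R).$$ -/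

import Mathlib

open MeasureTheory Set Filter Topology Asymptotics PowerSeries LaurentSeries

noncomputable section

namespace TernaryMenage

/-! ### Seating arrangements -/

/-- The clockwise neighbour of a seat at a round table with `m` (labelled) seats. -/
def next {m : ℕ} (i : Fin m) : Fin m := finRotate m i

/-- The `2n` persons are the pairs (couple, gender). A seating places them bijectively on the `2n`
labelled seats of a round table. It is admissible when no two spouses sit next to each other and no
three consecutive persons have the same gender. -/
def IsTernarySeating {n : ℕ} (σ : Fin (2 * n) ≃ Fin n × Bool) : Prop :=
  (∀ i, (σ i).1 ≠ (σ (next i)).1) ∧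
  ∀ i, ¬ ((σ i).2 = (σ (next i)).2 ∧ (σ (next i)).2 = (σ (next (next i))).2)

/-- The ternary menage number `T_n`. -/
def T (n : ℕ) : ℕ := Nat.card {σ : Fin (2 * n) ≃ Fin n × Bool // IsTernarySeating σ}

/-- The exponential generating function of `T_n`, a formal power series. -/
def egf : ℝ⟦X⟧ := PowerSeries.mk fun n => (T n : ℝ) / (n.factorial : ℝ)

/-! ### The polynomials, over an arbitrary commutative ring -/

section Polynomials

variable {R : Type*} [CommRing R] (p x t : R)

def a : R :=
  -2 * p ^ 5 * t ^ 3 + 2 * p ^ 4 * t ^ 4 + 4 * p ^ 5 * t ^ 2 - 8 * p ^ 4 * t ^ 3 - 2 * p ^ 5 * t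
    + 12 * p ^ 4 * t ^ 2 - 8 * p ^ 4 * t + 6 * p ^ 3 * t - 4 * p ^ 2 * t ^ 2
    + 16 * p ^ 2 - 10 * p * t + 20 * p + 6

def b : R := -(p ^ 2 * t * (2 + p - t) * (p - 3 * t + 6))

def c : R :=
  p ^ 6 * t ^ 2 - 2 * p ^ 5 * t ^ 3 + p ^ 4 * t ^ 4 + 4 * p ^ 5 * t ^ 2 - 4 * p ^ 4 * t ^ 3
    - 2 * p ^ 5 * t + 6 * p ^ 4 * t ^ 2 - 4 * p ^ 4 * t + 2 * p ^ 3 * t - p ^ 2 * t ^ 2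
    + 4 * p ^ 2 - 2 * p * t + 4 * p + 1

def d : R := -(p ^ 2 * t * (2 + p - t) ^ 2)

/-- The numerator of the integrand in the exponential generating function. -/
def egfNum : R :=
  t ^ 3 * x ^ 2 + (-2 * x ^ 3 - 4 * x ^ 2 - x) * t ^ 2
    + (x ^ 4 + 4 * x ^ 3 + 7 * x ^ 2 + 4 * x + 3) * t - 6 * x ^ 2 - 9 * x - 6

/-- The polynomial under the square root in the exponential generating function. -/
def egfRad : R :=
  (t ^ 2 * x ^ 2 - t * x ^ 3 - 2 * t * x ^ 2 - 3 * x * t + 4 * x ^ 2 + 4 * x + 1)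
    * (t ^ 2 * x ^ 2 - t * x ^ 3 - 2 * t * x ^ 2 + x * t + 1)

end Polynomials

/-! ### Formal square roots -/

/-- The formal square root `(1 + (f - 1))^(1/2)` of a power series with constant term `1`, obtained
by substituting `f - 1` in the binomial series. -/
def psSqrt (f : ℝ⟦X⟧) : ℝ⟦X⟧ := (PowerSeries.binomialSeries ℝ (1 / 2 : ℝ)).subst (f - 1)

theorem psSqrt_mul_self (f : ℝ⟦X⟧) (hf : constantCoeff f = 1) : psSqrt f * psSqrt f = f := by
  have h : HasSubst (f - 1) := HasSubst.of_constantCoeff_zero' (by simp [hf])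
  unfold psSqrt
  rw [← subst_mul h, ← binomialSeries_add, add_halves]
  have := binomialSeries_nat (R := ℝ) (A := ℝ) 1
  rw [Nat.cast_one, pow_one] at this
  rw [this, subst_add h, subst_X h, ← coe_substAlgHom h, map_one]
  ring

theorem constantCoeff_psSqrt (f : ℝ⟦X⟧) (hf : constantCoeff f = 1) :
    constantCoeff (psSqrt f) = 1 := by
  have h : HasSubst (f - 1) := HasSubst.of_constantCoeff_zero' (by simp [hf])
  have h0 : constantCoeff (f - 1) = 0 := by simp [hf]
  have e : PowerSeries.binomialSeries ℝ (1 / 2 : ℝ)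
      = 1 + X * PowerSeries.mk fun n => coeff (n + 1) (PowerSeries.binomialSeries ℝ (1 / 2 : ℝ)) := by
    rw [← sub_eq_iff_eq_add']
    have := sub_const_eq_X_mul_shift (PowerSeries.binomialSeries ℝ (1 / 2 : ℝ))
    simpa using this
  unfold psSqrt
  rw [e, subst_add h, subst_mul h, subst_X h, ← coe_substAlgHom h, map_one]
  simp [hf]

/-! ### The two formal integrands, for a fixed real `t`, as Laurent series in the variable -/

/-- `(a d - b c) / (d √(c² - 4 p² d²)) + b / d` as a formal Laurent series in `p`. -/
def coeffSeries (t : ℝ) : ℝ⸨X⸩ :=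
  let p : ℝ⟦X⟧ := X
  let s : ℝ⟦X⟧ := PowerSeries.C t
  ((a p s * d p s - b p s * c p s : ℝ⟦X⟧) : ℝ⸨X⸩)
      / ((d p s * psSqrt (c p s ^ 2 - 4 * p ^ 2 * d p s ^ 2) : ℝ⟦X⟧) : ℝ⸨X⸩)
    + ((b p s : ℝ⟦X⟧) : ℝ⸨X⸩) / ((d p s : ℝ⟦X⟧) : ℝ⸨X⸩)

/-- `egfNum / ((t - (x + 2)) √egfRad) - 2 x / (x + 2 - t)` as a formal Laurent series in `x`. -/
def egfSeries (t : ℝ) : ℝ⸨X⸩ :=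
  let x : ℝ⟦X⟧ := X
  let s : ℝ⟦X⟧ := PowerSeries.C t
  ((egfNum x s : ℝ⟦X⟧) : ℝ⸨X⸩)
      / (((s - (x + 2)) * psSqrt (egfRad x s) : ℝ⟦X⟧) : ℝ⸨X⸩)
    - ((2 * x : ℝ⟦X⟧) : ℝ⸨X⸩) / ((x + 2 - s : ℝ⟦X⟧) : ℝ⸨X⸩)

/-! ### Principal values, the exponential integral and the analytic integrand -/

section PrincipalValue

variable {E : Type*} [NormedAddCommGroup E] [NormedSpace ℝ E]

/-- The Cauchy principal value at `s` of the integral of `f` over `S` exists and equals `l`. -/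
def HasPV (S : Set ℝ) (f : ℝ → E) (s : ℝ) (l : E) : Prop :=
  (∀ ε > 0, IntegrableOn f (S \ Ioo (s - ε) (s + ε))) ∧
    Tendsto (fun ε => ∫ t in S \ Ioo (s - ε) (s + ε), f t) (𝓝[>] 0) (𝓝 l)

/-- The Cauchy principal value at `s` of the integral of `f` over `S`. -/
def pv [Nonempty E] (S : Set ℝ) (f : ℝ → E) (s : ℝ) : E :=
  limUnder (𝓝[>] (0 : ℝ)) fun ε => ∫ t in S \ Ioo (s - ε) (s + ε), f t

end PrincipalValue

/-- The exponential integral `Ei(s) = - PV ∫_{-s}^∞ e^{-u} / u du`. -/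
def Ei (s : ℝ) : ℝ := -pv (Ioi (-s)) (fun u : ℝ => Real.exp (-u) / u) 0

/-- The integrand in the exponential generating function; the square root is the principal one, a
complex number where the radicand is negative. -/
def egfIntegrand (x t : ℝ) : ℂ :=
  (egfNum x t : ℂ) * Real.exp (-t) / (((t - (x + 2) : ℝ) : ℂ) * (egfRad x t : ℂ) ^ (1 / 2 : ℂ))

/-- `-2 + 2x - 2x e^{-x-2} Ei(x+2) + PV ∫_0^∞ egfIntegrand x t dt`. -/
def egfClosedForm (x : ℝ) : ℂ :=
  ((-2 + 2 * x - 2 * x * Real.exp (-x - 2) * Ei (x + 2) : ℝ) : ℂ)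
    + pv (Ioi 0) (egfIntegrand x) (x + 2)

end TernaryMenage

end

/-!
For `n ≥ 2`, inclusion and exclusion over the set `S` of edges that join spouses expresses `T n` as
a signed sum over balanced gender words without three equal letters in a row, together with a set
`S` of disjoint edges joining different genders. Each such pair is realised by `n! (n - |S|)!`
seatings (`IsMarking.card_seatings`). Since `k! = ∫ tᵏ e⁻ᵗ dt`, this makes `T n / n!` the integral
against `e⁻ᵗ` of the polynomial `markedCount t n = ∑ (-1)^|S| t^(n - |S|)` (`T_div_factorial`).

The polynomial counts closed walks. A state consists of the gender on a seat and the type of the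
edge that leaves it, and the seats of the two genders carry the letters `u` and `v`; balanced words
are those with equal powers of `u` and `v`. The generating series of the traces of the powers of the
`6 × 6` transfer matrix is rational, with denominator `c₀ - g v - t g u`, where `c₀` and `g` are
polynomials in `x = u v` and `t`. Over the power series in `x` the denominator factors as
`κ (1 - α u) (1 - β v)`; this requires the root `s` of the discriminant `c₀² - 4 t x g²`, which is
`egfRad`. The diagonal can then be read off by partial fractions (`constTerm_of_factorization`), and
`markedSeries_mul_sqrt` results:
`(t - (x + 2)) (∑ markedCount t n xⁿ - 3) s = egfNum + 2 x s`.
This is the second formal integrand up to clearing denominators. The first one has the same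
coefficients, except for a constant, because `c + 2 p d = egfRad` and `c - 2 p d = c₀²`. The terms
of order `0` and `1`, where inclusion and exclusion is not available, account for the polynomial
`-2 + 2 x`.

For the analytic statement, `egfRad = (1 - x²)²` and `egfNum = -2 x (1 - x²)` at `t = x + 2`. Hence
the integrand is the sum of `regIntegrand`, which has no pole, and `2 x e⁻ᵗ / (x + 2 - t)`
(`egfIntegrand_eq`). The principal value of the latter is `2 x e^(-x-2) Ei (x + 2)`, which the
closed form subtracts, so that `-2 + 2 x + ∫ regIntegrand e⁻ᵗ` remains (`egfClosedForm_eq`).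

It has to be shown that the expansion of `regIntegrand` in powers of `x` may be integrated term by
term, up to `O(x^M)`. The algebraic equations of `s` and of the generating series hold over `ℝ[t]`,
so that their truncations satisfy them up to `x^M` times polynomials in `t`
(`exists_truncated_equations`). Where `|x| (1 + t)^K` is small the radicand is close to `1`, and the
equations bound the error by `|x|^M` times a power of `1 + t` (`abs_regular_sub_le`). Elsewhere
`1 / |x|` is bounded by a multiple of `(1 + t)^K`, so that every power of `|x|` can be gained at the
expense of powers of `1 + t`, and it suffices that the integrand has at most two inverse square root
singularities, at the simple zeros of the radicand (`exists_inv_norm_radSqrt_le`,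
`exists_pointwise_bound`). The factor `e⁻ᵗ` absorbs the powers of `1 + t`.
-/


noncomputable section

namespace TernaryMenage

/-! ### The transfer matrix -/

/-- A seat together with the cyclic edge leaving it: the gender of the occupant, and `0` if the
next occupant has the same gender, `1` if it has the other gender, `2` if it has the other gender
and the edge is marked as joining two spouses. -/
abbrev State := Bool × Fin 3

section Transfer

variable {R : Type*} [CommRing R] (t u v : R)

/-- The weight of the seat with state `r` when the preceding seat has state `s`: a seat of gender
`true` has weight `u` and an additional factor `t` if no marked edge ends there, a seat of gender
`false` has weight `v`, and a marked edge carries a sign. Incompatible states, three equal genders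
in a row and two adjacent marked edges have weight `0`. -/
def transfer : Matrix State State R := Matrix.of fun s r =>
  if r.1 = (if s.2 = 0 then s.1 else !s.1) ∧ ¬ (s.2 = 0 ∧ r.2 = 0) ∧ ¬ (s.2 = 2 ∧ r.2 = 2) then
    (if r.1 then (if s.2 = 2 ∨ r.2 = 2 then u else t * u) else v) * (if r.2 = 2 then -1 else 1)
  else 0

/-- The determinant of `1 - transfer t u v`. Apart from the product `u v` it is linear in each of
the letters, which is what makes its factorization into a part in `u` and a part in `v` possible. -/
def transferDet : R :=
  1 - (t - 2) * (u * v) - (u * v) ^ 2 * (t ^ 2 - 2 * t) + t * (u * v) ^ 3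
    - (u * v) * (t - 2 - u * v) * v - t * ((u * v) * (t - 2 - u * v)) * u

/-- The block of the adjugate of `1 - transfer t u v` from gender `true` to gender `true`. -/
def transferAdjTrueTrue : Matrix (Fin 3) (Fin 3) R :=
  !![1 + 2 * u * v + 2 * u * v ^ 2 + u ^ 2 * v ^ 2 + u ^ 2 * v ^ 3 - t * u * v - t * u * v ^ 2,
    u ^ 2 * v ^ 2 + t * u,
    -u - u ^ 2 * v - u ^ 2 * v ^ 2;
    -u * v - u * v ^ 2 - u ^ 2 * v ^ 2 - u ^ 2 * v ^ 3 + t * u * v + t * u * v ^ 2,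
    1 + u * v + u * v ^ 2 - u ^ 2 * v ^ 2 + t * u ^ 2 * v + t * u ^ 2 * v ^ 2,
    -u * v - u * v ^ 2 + u ^ 2 * v + u ^ 2 * v ^ 2 - t * u ^ 2 * v - t * u ^ 2 * v ^ 2;
    -u * v ^ 2 + t * u * v + t * u * v ^ 2,
    -u * v ^ 2 + t * u * v + t * u * v ^ 2 - t * u ^ 2 * v ^ 2 + t ^ 2 * u ^ 2 * v + t ^ 2 * u ^ 2 * v ^ 2,
    1 + u * v + u * v ^ 2 - t * u * v - t * u * v ^ 2 + t * u ^ 2 * v + t * u ^ 2 * v ^ 2 - t ^ 2 * u ^ 2 * v - t ^ 2 * u ^ 2 * v ^ 2]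

/-- The block of the adjugate of `1 - transfer t u v` from gender `true` to gender `false`. -/
def transferAdjTrueFalse : Matrix (Fin 3) (Fin 3) R :=
  !![-u * v - u ^ 2 * v ^ 2 + t * u * v,
    -u * v - u * v ^ 2 - u ^ 2 * v ^ 2 - u ^ 2 * v ^ 3 + t * u * v + t * u * v ^ 2,
    u * v ^ 2 - t * u * v - t * u * v ^ 2;
    v + u ^ 2 * v ^ 2,
    v + v ^ 2 + u ^ 2 * v ^ 2 + u ^ 2 * v ^ 3,
    -v - v ^ 2 - u * v ^ 2 - u * v ^ 3 - t * u ^ 2 * v ^ 2 - t * u ^ 2 * v ^ 3;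
    v + u * v ^ 2 + t * u ^ 2 * v ^ 2,
    v + v ^ 2 + u * v ^ 2 + u * v ^ 3 + t * u ^ 2 * v ^ 2 + t * u ^ 2 * v ^ 3,
    -v ^ 2 - t * u * v ^ 2 - t * u * v ^ 3 - t ^ 2 * u ^ 2 * v ^ 2 - t ^ 2 * u ^ 2 * v ^ 3]

/-- The block of the adjugate of `1 - transfer t u v` from gender `false` to gender `true`. -/
def transferAdjFalseTrue : Matrix (Fin 3) (Fin 3) R :=
  !![-u * v - u ^ 2 * v ^ 2 + t * u * v,
    -u * v - u ^ 2 * v ^ 2 + t * u * v - t * u ^ 2 * v - t * u ^ 3 * v ^ 2 + t ^ 2 * u ^ 2 * v,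
    -u * v + u ^ 2 * v - t * u ^ 2 * v;
    u ^ 2 * v ^ 2 + t * u,
    u ^ 2 * v ^ 2 + t * u + t * u ^ 3 * v ^ 2 + t ^ 2 * u ^ 2,
    -u - u ^ 2 * v - u ^ 2 * v ^ 2 - t * u ^ 2 - t * u ^ 3 * v - t * u ^ 3 * v ^ 2;
    u + u ^ 2 * v + u ^ 2 * v ^ 2,
    u + u ^ 2 * v + u ^ 2 * v ^ 2 + t * u ^ 2 + t * u ^ 3 * v + t * u ^ 3 * v ^ 2,
    -u ^ 2 - u ^ 2 * v - u ^ 2 * v ^ 2 - t * u ^ 3 * v - t * u ^ 3 * v ^ 2]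

/-- The block of the adjugate of `1 - transfer t u v` from gender `false` to gender `false`. -/
def transferAdjFalseFalse : Matrix (Fin 3) (Fin 3) R :=
  !![1 + 2 * u * v + u ^ 2 * v ^ 2 - t * u * v + 2 * t * u ^ 2 * v + t * u ^ 3 * v ^ 2 - t ^ 2 * u ^ 2 * v,
    v + u ^ 2 * v ^ 2,
    -v - u * v ^ 2 - t * u ^ 2 * v ^ 2;
    -u * v - u ^ 2 * v ^ 2 + t * u * v - t * u ^ 2 * v - t * u ^ 3 * v ^ 2 + t ^ 2 * u ^ 2 * v,
    1 + u * v + u * v ^ 2 - u ^ 2 * v ^ 2 + t * u ^ 2 * v + t * u ^ 2 * v ^ 2,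
    u * v ^ 2 - t * u * v - t * u * v ^ 2 + t * u ^ 2 * v ^ 2 - t ^ 2 * u ^ 2 * v - t ^ 2 * u ^ 2 * v ^ 2;
    u * v - u ^ 2 * v + t * u ^ 2 * v,
    u * v + u * v ^ 2 - u ^ 2 * v - u ^ 2 * v ^ 2 + t * u ^ 2 * v + t * u ^ 2 * v ^ 2,
    1 + u * v + u * v ^ 2 - t * u * v - t * u * v ^ 2 + t * u ^ 2 * v + t * u ^ 2 * v ^ 2 - t ^ 2 * u ^ 2 * v - t ^ 2 * u ^ 2 * v ^ 2]

/-- The adjugate of `1 - transfer t u v`, written out in blocks. -/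
def transferAdj : Matrix State State R := Matrix.of fun s r =>
  (if s.1 then (if r.1 then transferAdjTrueTrue t u v else transferAdjTrueFalse t u v)
    else (if r.1 then transferAdjFalseTrue t u v else transferAdjFalseFalse t u v)) s.2 r.2

theorem one_sub_transfer_mul_transferAdj :
    (1 - transfer t u v) * transferAdj t u v = transferDet t u v • 1 := by
  ext s r
  obtain ⟨g, e⟩ := s
  obtain ⟨h, f⟩ := r
  simp only [Matrix.sub_apply, Matrix.mul_apply, Fintype.sum_prod_type,
    Fintype.sum_bool, Fin.sum_univ_three, Matrix.smul_apply, smul_eq_mul]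
  cases g <;> cases h <;> fin_cases e <;> fin_cases f <;>
    simp [transfer, transferAdj, transferAdjTrueTrue, transferAdjTrueFalse,
      transferAdjFalseTrue, transferAdjFalseFalse, transferDet, Matrix.one_apply] <;> ring

theorem trace_transferAdj : (transferAdj t u v).trace =
    6 + (8 - 4 * t) * (u * v) + (4 * t - 2 * t ^ 2) * (u * v) ^ 2
      + (u * v) * (6 - 3 * t + u * v) * v + t * ((u * v) * (6 - 3 * t + u * v)) * u := by
  simp only [Matrix.trace, Matrix.diag, Fintype.sum_prod_type, Fintype.sum_bool, Fin.sum_univ_three]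
  simp [transferAdj, transferAdjTrueTrue, transferAdjFalseFalse]
  ring

end Transfer

/-! ### The generating series of the powers of a matrix -/

section PowSeries

variable {R ι : Type*} [CommRing R] [Fintype ι] [DecidableEq ι]

/-- The generating series `∑ Aᵐ zᵐ` of the powers of a matrix. -/
def powSeries (A : Matrix ι ι R) : Matrix ι ι R⟦X⟧ :=
  Matrix.of fun i j => PowerSeries.mk fun m => (A ^ m) i j

theorem powSeries_mul_one_sub (A : Matrix ι ι R) :
    powSeries A * (1 - (X : R⟦X⟧) • A.map PowerSeries.C) = 1 := by
  ext i j m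
  have h : powSeries A * (1 - (X : R⟦X⟧) • A.map PowerSeries.C)
      = powSeries A - (X : R⟦X⟧) • (powSeries A * A.map PowerSeries.C) := by
    rw [mul_sub, mul_one, Matrix.mul_smul]
  rw [h, Matrix.sub_apply, Matrix.smul_apply, smul_eq_mul, map_sub]
  rcases m with _ | m
  · by_cases hij : i = j <;> simp [powSeries, Matrix.one_apply, hij]
  · rw [coeff_succ_X_mul, Matrix.mul_apply, map_sum]
    have h1 : coeff (m + 1) ((1 : Matrix ι ι R⟦X⟧) i j) = 0 := by
      rw [Matrix.one_apply]; split_ifs <;> simp [coeff_one]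
    rw [h1]
    simp [powSeries, pow_succ, Matrix.mul_apply]

theorem trace_powSeries (A : Matrix ι ι R) :
    (powSeries A).trace = PowerSeries.mk fun m => (A ^ m).trace := by
  ext m
  simp [powSeries, Matrix.trace]

end PowSeries

/-! ### Constant terms of series in two letters -/

section ConstTerm

open LaurentPolynomial

variable {K : Type*} [CommRing K]

theorem coeff_laurent_T (m n : ℤ) :
    (LaurentPolynomial.T m : K[T;T⁻¹]).coeff n = if m = n then 1 else 0 := by
  change (AddMonoidAlgebra.single m (1 : K)).coeff n = _
  rw [AddMonoidAlgebra.coeff_single, Finsupp.single_apply]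

/-- The constant term in the auxiliary variable, which records the balance of the genders,
coefficient by coefficient. -/
def constTerm (f : K[T;T⁻¹]⟦X⟧) : K⟦X⟧ := PowerSeries.mk fun n => (coeff n f).coeff 0

theorem constTerm_add (f g : K[T;T⁻¹]⟦X⟧) : constTerm (f + g) = constTerm f + constTerm g := by
  ext n
  simp [constTerm]

theorem constTerm_map_mul (a : K⟦X⟧) (f : K[T;T⁻¹]⟦X⟧) :
    constTerm (PowerSeries.map LaurentPolynomial.C a * f) = a * constTerm f := by
  ext n
  simp only [constTerm, coeff_mk, coeff_mul, coeff_map]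
  have h : ∀ (s : Finset (ℕ × ℕ)) (g : ℕ × ℕ → K[T;T⁻¹]),
      (∑ i ∈ s, g i).coeff 0 = ∑ i ∈ s, (g i).coeff 0 := fun s g => by
    simp [AddMonoidAlgebra.coeff_sum]
  rw [h]
  refine Finset.sum_congr rfl fun i _ => ?_
  exact AddMonoidAlgebra.coeff_single_zero_mul ..

/-- A letter of the transfer matrix: the power series variable records the length of a word, the
Laurent variable its balance. The two letters in use are `letter 1` and `letter (-1)`. -/
def letter (ε : ℤ) : K[T;T⁻¹]⟦X⟧ := X * PowerSeries.C (LaurentPolynomial.T ε)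

theorem letter_pow (ε : ℤ) (k : ℕ) :
    (letter ε : K[T;T⁻¹]⟦X⟧) ^ k = X ^ k * PowerSeries.C (LaurentPolynomial.T (k * ε)) := by
  rw [letter, mul_pow, ← map_pow, LaurentPolynomial.T_pow]

theorem constTerm_X_pow_mul (k : ℕ) (f : K[T;T⁻¹]⟦X⟧) :
    constTerm (X ^ k * f) = X ^ k * constTerm f := by
  have := constTerm_map_mul (X ^ k : K⟦X⟧) f
  rwa [map_pow, PowerSeries.map_X] at this

theorem constTerm_one : constTerm (1 : K[T;T⁻¹]⟦X⟧) = 1 := by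
  ext n
  simp only [constTerm, coeff_mk, coeff_one]
  split_ifs
  · rw [← LaurentPolynomial.T_zero, coeff_laurent_T, if_pos rfl]
  · simp

theorem constTerm_letter_pow {ε : ℤ} (hε : ε ≠ 0) {k : ℕ} (hk : k ≠ 0) :
    constTerm ((letter ε : K[T;T⁻¹]⟦X⟧) ^ k) = 0 := by
  rw [letter_pow, constTerm_X_pow_mul]
  have : constTerm (PowerSeries.C (LaurentPolynomial.T (k * ε) : K[T;T⁻¹])) = 0 := by
    ext n
    simp only [constTerm, coeff_mk, PowerSeries.coeff_C]
    split_ifs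
    · have : (k : ℤ) * ε ≠ 0 := by positivity
      rw [coeff_laurent_T, if_neg this, map_zero]
    · simp
  rw [this, mul_zero]

/-- A geometric series in one letter only involves powers of one sign, so its positive multiples
have no constant term. -/
theorem constTerm_letter_pow_mul {ε : ℤ} (hε : ε ≠ 0) {a : K⟦X⟧} {E : K[T;T⁻¹]⟦X⟧}
    (hE : E = 1 + PowerSeries.map LaurentPolynomial.C a * (letter ε * E)) {k : ℕ} (hk : k ≠ 0) :
    constTerm (letter ε ^ k * E) = 0 := by
  have step : ∀ j k : ℕ, k ≠ 0 → X ^ (k + j) ∣ constTerm (letter ε ^ k * E) := by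
    intro j
    induction j with
    | zero =>
      intro k _
      rw [letter_pow, mul_assoc, constTerm_X_pow_mul]
      exact Dvd.intro _ rfl
    | succ j ih =>
      intro k hk
      have : letter ε ^ k * E = letter ε ^ k
          + PowerSeries.map LaurentPolynomial.C a * (letter ε ^ (k + 1) * E) := by
        conv_lhs => rw [hE]
        ring
      rw [this, constTerm_add, constTerm_letter_pow hε hk, zero_add, constTerm_map_mul]
      have := ih (k + 1) k.succ_ne_zero
      rw [show k + 1 + j = k + (j + 1) by ring] at this
      exact this.mul_left _
  ext n
  have := X_pow_dvd_iff.1 (step (n + 1) k hk) n (by lia)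
  simpa using this

/-- The embedding of `K⟦x⟧` into the two-letter series, `x` being the product of the letters. As
the product has length `2` and balance `0`, this substitutes the square of the variable. -/
def diagHom : K⟦X⟧ →+* K[T;T⁻¹]⟦X⟧ :=
  (PowerSeries.map LaurentPolynomial.C).comp (PowerSeries.expand 2 two_ne_zero).toRingHom

theorem constTerm_diagHom_mul (a : K⟦X⟧) (f : K[T;T⁻¹]⟦X⟧) :
    constTerm (diagHom a * f) = PowerSeries.expand 2 two_ne_zero a * constTerm f :=
  constTerm_map_mul _ _

theorem letter_mul_letter_neg :
    (letter 1 * letter (-1) : K[T;T⁻¹]⟦X⟧) = diagHom X := by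
  have : (PowerSeries.C (LaurentPolynomial.T 1 : K[T;T⁻¹]))
      * PowerSeries.C (LaurentPolynomial.T (-1)) = 1 := by
    rw [← map_mul, ← LaurentPolynomial.T_add]; simp
  simp only [letter, diagHom, RingHom.comp_apply, AlgHom.toRingHom_eq_coe, RingHom.coe_coe,
    PowerSeries.expand_X, map_pow, PowerSeries.map_X]
  linear_combination X ^ 2 * this

theorem exists_geometric (a : K⟦X⟧) (ε : ℤ) :
    ∃ E : K[T;T⁻¹]⟦X⟧, (1 - diagHom a * letter ε) * E = 1 := by
  have : IsUnit (1 - diagHom a * letter ε : K[T;T⁻¹]⟦X⟧) := by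
    rw [PowerSeries.isUnit_iff_constantCoeff]
    simp [letter]
  exact this.exists_right_inv

/-- Extraction of the diagonal of a rational series whose denominator has been factored into a
part in `u` and a part in `v`. Partial fractions separate the two geometric series; each of them
has only powers of one sign, so that it contributes its first term alone. -/
theorem constTerm_of_factorization (κ α β n₀ n₁ n₂ : K⟦X⟧) (F : K[T;T⁻¹]⟦X⟧)
    (hF : F * (diagHom κ * ((1 - diagHom α * letter 1) * (1 - diagHom β * letter (-1))))
      = diagHom n₀ + diagHom n₁ * letter (-1) + diagHom n₂ * letter 1) :
    constTerm F * PowerSeries.expand 2 two_ne_zero (κ * (1 - α * β * X))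
      = PowerSeries.expand 2 two_ne_zero (n₀ + (n₁ * α + n₂ * β) * X) := by
  obtain ⟨P, hP⟩ := exists_geometric α 1
  obtain ⟨Q, hQ⟩ := exists_geometric β (-1)
  have huv := letter_mul_letter_neg (K := K)
  set u : K[T;T⁻¹]⟦X⟧ := letter 1
  set v : K[T;T⁻¹]⟦X⟧ := letter (-1)
  have hP' : P = 1 + diagHom α * (u * P) := by linear_combination hP
  have hQ' : Q = 1 + diagHom β * (v * Q) := by linear_combination hQ
  -- the partial fraction decomposition of the product of the two geometric series
  have hpf : diagHom (1 - α * β * X) * (P * Q) = P + diagHom β * (v * Q) := by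
    simp only [map_sub, map_mul, map_one, ← huv]
    linear_combination (Q * diagHom β * v) * hP + P * hQ
  have hmain : diagHom (κ * (1 - α * β * X)) * F
      = diagHom n₀ * (P + diagHom β * (v * Q))
        + diagHom n₁ * (v + diagHom α * (diagHom X * P) + diagHom β * (v ^ 2 * Q))
        + diagHom n₂ * (u ^ 1 * P + diagHom β * (diagHom X * Q)) := by
    have e : diagHom κ * F = (diagHom n₀ + diagHom n₁ * v + diagHom n₂ * u) * (P * Q) := by
      rw [← hF]
      linear_combination -(F * diagHom κ) * hP * ((1 - diagHom β * v) * Q) - F * diagHom κ * hQ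
    rw [map_mul, mul_right_comm, e, mul_assoc, mul_comm (P * Q), hpf, ← huv]
    linear_combination diagHom n₁ * v * hP'
  have hv : constTerm v = 0 := by
    simpa using constTerm_letter_pow (K := K) (ε := -1) (by norm_num) one_ne_zero
  have hu1 : constTerm (u ^ 1 * P) = 0 := constTerm_letter_pow_mul (by norm_num) hP' one_ne_zero
  have hv1 : constTerm (v ^ 1 * Q) = 0 := constTerm_letter_pow_mul (by norm_num) hQ' one_ne_zero
  have hv2 : constTerm (v ^ 2 * Q) = 0 := constTerm_letter_pow_mul (by norm_num) hQ' two_ne_zero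
  rw [pow_one] at hv1
  have hcP : constTerm P = 1 := by
    rw [hP', constTerm_add, constTerm_diagHom_mul, constTerm_one, ← pow_one u, hu1]; simp
  have hcQ : constTerm Q = 1 := by
    rw [hQ', constTerm_add, constTerm_diagHom_mul, constTerm_one, hv1]; simp
  have := congrArg constTerm hmain
  simp only [constTerm_add, constTerm_diagHom_mul, hv, hu1, hv1, hv2, hcP, hcQ] at this
  rw [mul_comm, this]
  simp only [map_add, map_mul]
  ring

end ConstTerm

/-! ### The generating series of the balanced closed walks -/

section Diagonal

open LaurentPolynomial

variable {K : Type*} [CommRing K]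

/-- The weighted number of cyclic state sequences with `n` seats of each gender, as a polynomial in
the weight `t` of the seats of one gender at which no marked edge ends. For `n = 0` this is the
trace of the identity matrix, `6`. -/
def markedCount (t : K) (n : ℕ) : K :=
  ((transfer (LaurentPolynomial.C t) (LaurentPolynomial.T 1) (LaurentPolynomial.T (-1)) ^
    (2 * n)).trace).coeff 0

/-- The generating series of `markedCount`. -/
def markedSeries (t : K) : K⟦X⟧ := PowerSeries.mk (markedCount t)

theorem smul_transfer_map (t : K) :
    (X : K[T;T⁻¹]⟦X⟧) • (transfer (LaurentPolynomial.C t) (LaurentPolynomial.T 1)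
        (LaurentPolynomial.T (-1))).map PowerSeries.C
      = transfer (diagHom (PowerSeries.C t)) (letter 1) (letter (-1)) := by
  have ht : diagHom (PowerSeries.C t) = PowerSeries.C (LaurentPolynomial.C t) := by
    simp [diagHom, PowerSeries.expand_C]
  ext1 s r
  simp only [Matrix.smul_apply, Matrix.map_apply, transfer, Matrix.of_apply, ht, letter,
    smul_eq_mul]
  split_ifs <;> simp <;> ring

theorem trace_powSeries_mul_det (t : K) :
    (powSeries (transfer (LaurentPolynomial.C t) (LaurentPolynomial.T 1)
        (LaurentPolynomial.T (-1)))).trace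
      * transferDet (diagHom (PowerSeries.C t)) (letter 1) (letter (-1))
      = (transferAdj (diagHom (PowerSeries.C t)) (letter 1) (letter (-1))).trace := by
  have h := powSeries_mul_one_sub (transfer (LaurentPolynomial.C t) (LaurentPolynomial.T 1)
        (LaurentPolynomial.T (-1)))
  rw [smul_transfer_map] at h
  have h2 := congrArg (powSeries (transfer (LaurentPolynomial.C t) (LaurentPolynomial.T 1)
        (LaurentPolynomial.T (-1))) * ·)
      (one_sub_transfer_mul_transferAdj (diagHom (PowerSeries.C t)) (letter 1) (letter (-1)))
  beta_reduce at h2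
  rw [← Matrix.mul_assoc, h, Matrix.one_mul, Matrix.mul_smul, Matrix.mul_one] at h2
  rw [h2, Matrix.trace_smul, smul_eq_mul, mul_comm]

/-- The radicand is the discriminant of the determinant of `1 - transfer`: writing that determinant
as `c₀ - g v - t g u` with `c₀` and `g` in `x = u v`, it is `c₀² - 4 t x g²`. -/
theorem egfRad_eq {R : Type*} [CommRing R] (x t : R) : egfRad x t =
    (1 - (t - 2) * x - x ^ 2 * (t ^ 2 - 2 * t) + t * x ^ 3) ^ 2
      - 4 * t * x * (x * (t - 2 - x)) ^ 2 := by
  unfold egfRad; ring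

theorem egfNum_eq {R : Type*} [CommRing R] (x t : R) : egfNum x t =
    (6 + (8 - 4 * t) * x + (4 * t - 2 * t ^ 2) * x ^ 2) * (t - 2 - x)
      + (6 - 3 * t + x) * (1 - (t - 2) * x - x ^ 2 * (t ^ 2 - 2 * t) + t * x ^ 3) := by
  unfold egfNum; ring

/-- The generating series of the weighted counts in terms of a square root of `egfRad`, the identity
that carries both integral formulas. The denominator is factored over the power series as
`κ (1 - α u) (1 - β v)`, and the diagonal is extracted from this. -/
theorem markedSeries_mul_sqrt [Invertible (2 : K)] (t : K) (s : K⟦X⟧)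
    (hs : s * s = egfRad X (PowerSeries.C t)) (hs0 : constantCoeff s = 1) :
    (PowerSeries.C t - (X + 2)) * (markedSeries t - 3) * s
      = egfNum X (PowerSeries.C t) + 2 * X * s := by
  set τ : K⟦X⟧ := PowerSeries.C t with hτ
  set c₀ : K⟦X⟧ := 1 - (τ - 2) * X - X ^ 2 * (τ ^ 2 - 2 * τ) + τ * X ^ 3 with hc₀
  set g : K⟦X⟧ := X * (τ - 2 - X) with hg
  have hs' : s * s = c₀ ^ 2 - 4 * τ * X * g ^ 2 := by rw [hs, egfRad_eq]
  -- the determinant `c₀ - g v - t g u` equals `κ (1 - α u) (1 - β v)` if `κ α = t g`, `κ β = g` and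
  -- `κ + κ α β x = c₀`; so `κ` is the root with constant term `1` of `κ² - c₀ κ + t x g² = 0`
  set κ : K⟦X⟧ := PowerSeries.C (⅟2) * (c₀ + s) with hκ
  have h2 : PowerSeries.C (⅟2 : K) * 2 = 1 := by
    have : (2 : K⟦X⟧) = PowerSeries.C (2 : K) := (map_ofNat PowerSeries.C 2).symm
    rw [this, ← map_mul, invOf_mul_self, map_one]
  have h2κ : 2 * κ = c₀ + s := by rw [hκ]; linear_combination (c₀ + s) * h2
  have hκu : IsUnit κ := by
    rw [PowerSeries.isUnit_iff_constantCoeff]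
    have : constantCoeff κ = 1 := by
      have h : (⅟2 : K) * (1 + 1) = 1 := by rw [one_add_one_eq_two, invOf_mul_self]
      simp [hκ, hc₀, hs0, h]
    rw [this]; exact isUnit_one
  have hsu : IsUnit s := by
    rw [PowerSeries.isUnit_iff_constantCoeff, hs0]; exact isUnit_one
  obtain ⟨κi, hκi⟩ := hκu.exists_right_inv
  obtain ⟨si, hsi⟩ := hsu.exists_right_inv
  have hroot : κ * (c₀ - κ) = τ * X * g ^ 2 := by
    have h4 : 4 * (κ * (c₀ - κ)) = 4 * (τ * X * g ^ 2) := by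
      linear_combination (2 * c₀ - (2 * κ + c₀ + s)) * h2κ - hs'
    have := congrArg (fun z => PowerSeries.C (⅟2 : K) * PowerSeries.C (⅟2 : K) * z) h4
    beta_reduce at this
    linear_combination this
      - (1 + PowerSeries.C (⅟2 : K) * 2) * (κ * (c₀ - κ) - τ * X * g ^ 2) * h2
  set β : K⟦X⟧ := g * κi with hβ
  set α : K⟦X⟧ := τ * g * κi with hα
  have hβκ : κ * β = g := by rw [hβ]; linear_combination g * hκi
  have hακ : κ * α = τ * g := by rw [hα]; linear_combination τ * g * hκi
  have hαβ : κ * (α * β * X) = c₀ - κ := by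
    have : κ * (α * β * X) = κi * (κ * (c₀ - κ)) := by
      rw [hroot, hα, hβ]; linear_combination (τ * g * (g * κi) * X) * hκi
    rw [this]; linear_combination (c₀ - κ) * hκi
  have hsκ : κ * (1 - α * β * X) = s := by linear_combination h2κ - hαβ
  set n₁ : K⟦X⟧ := X * (6 - 3 * τ + X) with hn₁
  set n₀ : K⟦X⟧ := 6 + (8 - 4 * τ) * X + (4 * τ - 2 * τ ^ 2) * X ^ 2 with hn₀
  have key := constTerm_of_factorization κ α β n₀ n₁ (τ * n₁) _ (by
    have h := trace_powSeries_mul_det t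
    rw [trace_transferAdj, letter_mul_letter_neg, ← hτ] at h
    have hdet : transferDet (diagHom τ) (letter 1) (letter (-1))
        = diagHom κ * ((1 - diagHom α * letter 1) * (1 - diagHom β * letter (-1))) := by
      have e1 : diagHom (κ * α) = diagHom (τ * g) := by rw [hακ]
      have e2 : diagHom (κ * β) = diagHom g := by rw [hβκ]
      have e3 : diagHom (κ * (α * β * X)) = diagHom (c₀ - κ) := by rw [hαβ]
      simp only [transferDet, letter_mul_letter_neg]
      simp only [hg, hc₀, map_mul, map_sub, map_add, map_pow, map_one, map_ofNat] at e1 e2 e3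
      rw [← letter_mul_letter_neg] at *
      linear_combination letter 1 * e1 + letter (-1) * e2 - e3
    rw [← hdet, h]
    simp only [hn₁, hn₀, map_mul, map_sub, map_add, map_pow, map_ofNat])
  rw [hsκ] at key
  have hmarked : markedSeries t = (n₀ + (n₁ * α + τ * n₁ * β) * X) * si := by
    have h1 : constTerm (powSeries (transfer (LaurentPolynomial.C t) (LaurentPolynomial.T 1)
        (LaurentPolynomial.T (-1)))).trace
        = PowerSeries.expand 2 two_ne_zero ((n₀ + (n₁ * α + τ * n₁ * β) * X) * si) := by
      rw [map_mul, ← key, mul_assoc, ← map_mul, hsi, map_one, mul_one]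
    ext n
    rw [← PowerSeries.coeff_expand_mul 2 two_ne_zero ((n₀ + _) * si) n, ← h1]
    simp [markedSeries, markedCount, constTerm, trace_powSeries]
  have hm : markedSeries t * s = n₀ + (n₁ * α + τ * n₁ * β) * X := by
    rw [hmarked]; linear_combination (n₀ + (n₁ * α + τ * n₁ * β) * X) * hsi
  have hαβ' : τ * X * g ^ 2 * κi = c₀ - κ := by rw [← hroot]; linear_combination (c₀ - κ) * hκi
  have hnum : egfNum X τ = n₀ * (τ - 2 - X) + (6 - 3 * τ + X) * c₀ := by
    rw [egfNum_eq]
  rw [hnum]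
  have : (τ - (X + 2)) * (markedSeries t - 3) * s
      = (τ - 2 - X) * (markedSeries t * s) - 3 * (τ - 2 - X) * s := by ring
  rw [this, hm, hα, hβ, hn₁]
  have e : (τ - 2 - X) * ((X * (6 - 3 * τ + X) * (τ * g * κi)
      + τ * (X * (6 - 3 * τ + X)) * (g * κi)) * X)
      = 2 * (6 - 3 * τ + X) * (τ * X * g ^ 2 * κi) := by rw [hg]; ring
  rw [mul_add, e, hαβ']
  linear_combination (-(6 - 3 * τ + X)) * h2κ

end Diagonal

/-! ### Traces as sums over closed walks -/

section ClosedWalks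

variable {R ι : Type*} [CommRing R] [Fintype ι] [DecidableEq ι]

theorem pow_apply_eq_sum_walks (A : Matrix ι ι R) (k : ℕ) (i j : ι) :
    (A ^ k) i j = ∑ s : Fin k → ι,
      if (Fin.cons i s : Fin (k + 1) → ι) (Fin.last k) = j then
        ∏ l : Fin k, A ((Fin.cons i s : Fin (k + 1) → ι) l.castSucc) (s l) else 0 := by
  induction k generalizing i with
  | zero => simp [Matrix.one_apply]
  | succ k ih =>
    rw [pow_succ', Matrix.mul_apply, ← (Fin.consEquiv fun _ : Fin (k + 1) => ι).sum_comp,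
      Fintype.sum_prod_type]
    refine Finset.sum_congr rfl fun c _ => ?_
    rw [ih, Finset.mul_sum]
    refine Finset.sum_congr rfl fun s _ => ?_
    rw [← Fin.succ_last]
    simp only [Fin.consEquiv_apply, Fin.cons_succ, Fin.prod_univ_succ, Fin.castSucc_zero,
      Fin.cons_zero, ← Fin.succ_castSucc]
    rw [mul_ite, mul_zero]

/-- The trace of a power of a matrix is the weighted number of closed walks. -/
theorem trace_pow_eq_sum_closed_walks (A : Matrix ι ι R) {m : ℕ} (hm : m ≠ 0) :
    (A ^ m).trace = ∑ s : Fin m → ι, ∏ i, A (s i) (s (next i)) := by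
  cases m with
  | zero => exact absurd rfl hm
  | succ k =>
  rw [← (Fin.consEquiv fun _ : Fin (k + 1) => ι).sum_comp, Fintype.sum_prod_type, Matrix.trace]
  refine Finset.sum_congr rfl fun a _ => ?_
  rw [Matrix.diag_apply, pow_succ, Matrix.mul_apply]
  simp only [pow_apply_eq_sum_walks, Finset.sum_mul]
  rw [Finset.sum_comm]
  refine Finset.sum_congr rfl fun s _ => ?_
  simp only [ite_mul, zero_mul, Finset.sum_ite_eq, Finset.mem_univ, if_true]
  rw [Fin.prod_univ_castSucc]
  congr 1
  · refine Finset.prod_congr rfl fun i _ => ?_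
    have : next (i.castSucc) = i.succ := by
      rw [next, finRotate_apply]; exact Fin.coeSucc_eq_succ
    rw [this]; simp
  · have : next (Fin.last k) = 0 := by rw [next, finRotate_last]
    rw [this]; simp

end ClosedWalks

/-! ### Gender words with marked edges -/

section Markings

variable {n : ℕ}

theorem next_injective {m : ℕ} : Function.Injective (next (m := m)) := (finRotate m).injective

theorem next_surjective {m : ℕ} : Function.Surjective (next (m := m)) := (finRotate m).surjective

theorem next_bijective {m : ℕ} : Function.Bijective (next (m := m)) := (finRotate m).bijective

/-- A gender word `w` on the seats of a round table together with a set `S` of marked cyclic edges,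
the edge `i` joining the seats `i` and `next i`: no three consecutive genders agree, and the marked
edges are pairwise disjoint and join different genders. -/
structure IsMarking {m : ℕ} (w : Fin m → Bool) (S : Finset (Fin m)) : Prop where
  alternating : ∀ i, ¬ (w i = w (next i) ∧ w (next i) = w (next (next i)))
  ne_next : ∀ i ∈ S, w i ≠ w (next i)
  next_notMem : ∀ i ∈ S, next i ∉ S

/-- The seat of gender `true` on the edge `i`, if the edge joins different genders. -/
def trueEnd {m : ℕ} (w : Fin m → Bool) (i : Fin m) : Fin m := if w i then i else next i

theorem IsMarking.apply_trueEnd {m : ℕ} {w : Fin m → Bool} {S : Finset (Fin m)}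
    (h : IsMarking w S) {i : Fin m} (hi : i ∈ S) : w (trueEnd w i) = true := by
  have := h.ne_next i hi
  unfold trueEnd
  split_ifs with hw
  · exact hw
  · cases h1 : w (next i) <;> simp_all

theorem IsMarking.trueEnd_injOn {m : ℕ} {w : Fin m → Bool} {S : Finset (Fin m)}
    (h : IsMarking w S) : Set.InjOn (trueEnd w) S := by
  intro i hi j hj hij
  have hi' := h.next_notMem i hi
  have hj' := h.next_notMem j hj
  unfold trueEnd at hij
  split_ifs at hij
  · exact hij
  · exact absurd (hij ▸ hi) hj'
  · exact absurd (hij ▸ hj) hi'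
  · exact next_injective hij

open Classical in
/-- The number of seats of gender `true` at which no marked edge ends. -/
theorem IsMarking.card_free {w : Fin (2 * n) → Bool} {S : Finset (Fin (2 * n))}
    (h : IsMarking w S) (hw : (Finset.univ.filter fun i => w i = true).card = n) :
    (Finset.univ.filter fun i => w (next i) = true ∧ ¬ (i ∈ S ∨ next i ∈ S)).card + S.card = n := by
  have h1 : S.card = (Finset.univ.filter fun i =>
      w (next i) = true ∧ (i ∈ S ∨ next i ∈ S)).card := by
    have : (S.image (trueEnd w)) = (Finset.univ.filter fun i =>
        w (next i) = true ∧ (i ∈ S ∨ next i ∈ S)).image next := by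
      ext j
      simp only [Finset.mem_image, Finset.mem_filter, Finset.mem_univ, true_and]
      constructor
      · rintro ⟨i, hi, rfl⟩
        obtain ⟨j, hj⟩ := next_surjective (trueEnd w i)
        refine ⟨j, ⟨hj ▸ h.apply_trueEnd hi, ?_⟩, hj⟩
        unfold trueEnd at hj
        split_ifs at hj
        · right; rwa [hj]
        · left; rwa [next_injective hj]
      · rintro ⟨i, ⟨hwi, hi | hi⟩, rfl⟩
        · refine ⟨i, hi, ?_⟩
          have := h.ne_next i hi
          rw [hwi] at this
          simp [trueEnd, this]
        · exact ⟨next i, hi, by simp [trueEnd, hwi]⟩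
    rw [← Finset.card_image_of_injOn h.trueEnd_injOn, this,
      Finset.card_image_of_injective _ next_injective]
  have h2 : (Finset.univ.filter fun i => w (next i) = true).card = n := by
    refine (Finset.card_bij (fun i _ => next i) (by simp) (fun _ _ _ _ e => next_injective e)
      fun j hj => ?_).trans hw
    obtain ⟨i, rfl⟩ := next_surjective j
    exact ⟨i, by simpa using hj, rfl⟩
  rw [h1, add_comm]
  refine Eq.trans ?_ h2
  have := Finset.card_filter_add_card_filter_not (s := Finset.univ.filter fun i => w (next i) = true)
    (fun i => i ∈ S ∨ next i ∈ S)
  rwa [Finset.filter_filter, Finset.filter_filter] at this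

/-- The state sequence of a gender word with marked edges. -/
def states {m : ℕ} (w : Fin m → Bool) (S : Finset (Fin m)) (i : Fin m) : State :=
  (w i, if i ∈ S then 2 else if w i = w (next i) then 0 else 1)

theorem states_injective {m : ℕ} :
    Function.Injective fun x : (Fin m → Bool) × Finset (Fin m) => states x.1 x.2 := by
  rintro ⟨w, S⟩ ⟨w', S'⟩ h
  have h1 : w = w' := funext fun i => congrArg Prod.fst (congrFun h i)
  subst h1
  have h2 : S = S' := by
    ext i
    have := congrArg Prod.snd (congrFun h i)
    simp only [states] at this
    split_ifs at this <;> simp_all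
  rw [h2]

theorem IsMarking.transfer_states {R : Type*} [CommRing R] {m : ℕ} {w : Fin m → Bool}
    {S : Finset (Fin m)} (h : IsMarking w S) (t u v : R) (i : Fin m) :
    transfer t u v (states w S i) (states w S (next i)) =
      (if w (next i) then (if i ∈ S ∨ next i ∈ S then u else t * u) else v)
        * (if next i ∈ S then -1 else 1) := by
  have h1 := h.alternating i
  have h2 := h.ne_next i
  have h3 := h.next_notMem i
  have h4 := h.ne_next (next i)
  simp only [transfer, states, Matrix.of_apply]
  clear h
  generalize w i = a at *
  generalize w (next i) = b at *
  generalize w (next (next i)) = c at *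
  by_cases hi : i ∈ S <;> by_cases hn : next i ∈ S <;> cases a <;> cases b <;> cases c <;> simp_all

theorem exists_isMarking_of_transfer_ne_zero {R : Type*} [CommRing R] {m : ℕ} {t u v : R}
    {s : Fin m → State} (h : ∀ i, transfer t u v (s i) (s (next i)) ≠ 0) :
    ∃ w S, IsMarking w S ∧ states w S = s := by
  have h' : ∀ i, (s (next i)).1 = (if (s i).2 = 0 then (s i).1 else !(s i).1) ∧
      ¬ ((s i).2 = 0 ∧ (s (next i)).2 = 0) ∧ ¬ ((s i).2 = 2 ∧ (s (next i)).2 = 2) := by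
    intro i
    have := h i
    rw [transfer, Matrix.of_apply] at this
    by_contra hc
    rw [if_neg hc] at this
    exact this rfl
  have hz : ∀ i, (s i).1 = (s (next i)).1 ↔ (s i).2 = 0 := by
    intro i
    have := (h' i).1
    split_ifs at this with h0 <;> simp [this, h0]
  refine ⟨fun i => (s i).1, Finset.univ.filter fun i => (s i).2 = 2, ⟨?_, ?_, ?_⟩, ?_⟩
  · rintro i ⟨h1, h2⟩
    exact (h' i).2.1 ⟨(hz i).1 h1, (hz _).1 h2⟩
  · intro i hi he
    have h1 : (s i).2 = 2 := by simpa using hi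
    have h2 : (s i).2 = 0 := (hz i).1 he
    rw [h1] at h2; exact absurd h2 (by decide)
  · intro i hi hn
    exact (h' i).2.2 ⟨by simpa using hi, by simpa using hn⟩
  · funext i
    refine Prod.ext rfl ?_
    simp only [states, Finset.mem_filter, Finset.mem_univ, true_and, hz]
    generalize (s i).2 = e
    fin_cases e <;> simp

open Classical LaurentPolynomial in
/-- `markedCount` as a signed sum over balanced gender words with marked edges. The state sequences
without a vanishing factor are exactly those of gender words with marked edges, and the constant
term selects the balanced ones. -/
theorem markedCount_eq_sum {K : Type*} [CommRing K] (t : K) (hn : n ≠ 0) :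
    markedCount t n = ∑ x : (Fin (2 * n) → Bool) × Finset (Fin (2 * n)),
      if IsMarking x.1 x.2 ∧ (Finset.univ.filter fun i => x.1 i = true).card = n then
        (-1) ^ x.2.card * t ^ (n - x.2.card) else 0 := by
  rw [markedCount, trace_pow_eq_sum_closed_walks _ (by lia)]
  set A := transfer (LaurentPolynomial.C t) (LaurentPolynomial.T 1) (LaurentPolynomial.T (-1))
  have hsum : ∑ s : Fin (2 * n) → State, ∏ i, A (s i) (s (next i))
      = ∑ x : (Fin (2 * n) → Bool) × Finset (Fin (2 * n)), if IsMarking x.1 x.2 then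
        ∏ i, A (states x.1 x.2 i) (states x.1 x.2 (next i)) else 0 := by
    rw [← Finset.sum_filter]
    symm
    refine Finset.sum_of_injOn (fun x => states x.1 x.2) states_injective.injOn (by simp) ?_ (by simp)
    intro s _ hs
    by_contra hne
    apply hs
    obtain ⟨w, S, h1, h2⟩ := exists_isMarking_of_transfer_ne_zero (s := s)
      (fun i h0 => hne (Finset.prod_eq_zero (Finset.mem_univ i) h0))
    exact ⟨(w, S), by simpa using h1, h2⟩
  rw [hsum, AddMonoidAlgebra.coeff_sum, Finsupp.finsetSum_apply]
  refine Finset.sum_congr rfl ?_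
  rintro ⟨w, S⟩ -
  by_cases hm : IsMarking w S
  swap
  · simp [hm]
  simp only [hm, if_true, true_and]
  have hprod : ∏ i, A (states w S i) (states w S (next i))
      = LaurentPolynomial.C ((-1) ^ S.card * t ^ (Finset.univ.filter fun i =>
          w (next i) = true ∧ ¬ (i ∈ S ∨ next i ∈ S)).card)
        * LaurentPolynomial.T (∑ i, if w i then 1 else -1) := by
    have h1 : ∏ i, (if next i ∈ S then (-1 : K[T;T⁻¹]) else 1) = (-1) ^ S.card := by
      rw [next_bijective.prod_comp fun i => if i ∈ S then (-1 : K[T;T⁻¹]) else 1]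
      simp
    have h2 : ∀ f : Fin (2 * n) → ℤ,
        ∏ i, (LaurentPolynomial.T (f i) : K[T;T⁻¹]) = LaurentPolynomial.T (∑ i, f i) := by
      intro f
      induction (Finset.univ : Finset (Fin (2 * n))) using Finset.induction_on with
      | empty => simp
      | insert a s ha ih => rw [Finset.prod_insert ha, Finset.sum_insert ha, ih, LaurentPolynomial.T_add]
    have h3 : ∀ i, (if w (next i) then (if i ∈ S ∨ next i ∈ S then LaurentPolynomial.T 1
          else LaurentPolynomial.C t * LaurentPolynomial.T 1) else LaurentPolynomial.T (-1) : K[T;T⁻¹])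
        = LaurentPolynomial.C (if w (next i) = true ∧ ¬ (i ∈ S ∨ next i ∈ S) then t else 1)
          * LaurentPolynomial.T (if w (next i) then 1 else -1) := by
      intro i
      by_cases h : w (next i) = true <;> by_cases h' : i ∈ S ∨ next i ∈ S <;> simp [h, h']
    simp only [A, hm.transfer_states, Finset.prod_mul_distrib, h3]
    rw [h1, h2, ← map_prod, Finset.prod_ite, Finset.prod_const, Finset.prod_const_one, mul_one,
      next_bijective.sum_comp fun i => if w i then (1 : ℤ) else -1]
    simp only [map_mul, map_pow, map_neg, map_one]
    ring
  have hbal : (∑ i, if w i then (1 : ℤ) else -1) = 0 ↔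
      (Finset.univ.filter fun i => w i = true).card = n := by
    have := Finset.card_filter_add_card_filter_not (s := (Finset.univ : Finset (Fin (2 * n))))
      (fun i => w i = true)
    rw [Finset.card_univ, Fintype.card_fin] at this
    rw [Finset.sum_ite]
    simp only [Finset.sum_const, nsmul_eq_mul, mul_one, mul_neg]
    lia
  rw [hprod, ← LaurentPolynomial.single_eq_C_mul_T, AddMonoidAlgebra.coeff_single,
    Finsupp.single_apply]
  by_cases hb : (Finset.univ.filter fun i => w i = true).card = n
  · rw [if_pos (hbal.2 hb), if_pos hb]
    congr 2
    have := hm.card_free hb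
    lia
  · rw [if_neg (mt hbal.1 hb), if_neg hb]

end Markings

/-! ### Inclusion and exclusion over the edges that join spouses -/

section Couples

/-- A bijection between finite types with prescribed values on a subset. -/
theorem exists_equiv_extending {α β γ : Type*} [Finite γ] [Finite α] (f : γ → α) (g : γ → β)
    (hf : Function.Injective f) (hg : Function.Injective g) (e : α ≃ β) :
    ∃ e' : α ≃ β, ∀ c, e' (f c) = g c := by
  classical
  have hf' : Function.Injective (e ∘ f) := e.injective.comp hf
  have : Finite β := Finite.of_equiv α e
  have := Fintype.ofFinite β
  let k : {x // x ∈ Set.range (e ∘ f)} ≃ {x // x ∈ Set.range g} :=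
    (Equiv.ofInjective _ hf').symm.trans (Equiv.ofInjective _ hg)
  refine ⟨e.trans k.extendSubtype, fun c => ?_⟩
  have : k ⟨(e ∘ f) c, c, rfl⟩ = ⟨g c, c, rfl⟩ := by
    simp only [k, Equiv.trans_apply]
    rw [Equiv.ofInjective_symm_apply hf' c]
    rfl
  rw [Equiv.trans_apply, show e (f c) = (e ∘ f) c from rfl,
    Equiv.extendSubtype_apply_of_mem _ _ ⟨c, rfl⟩, this]

open Classical in
theorem card_perm_fixing {n : ℕ} (s : Finset (Fin n)) :
    Fintype.card {ρ : Equiv.Perm (Fin n) // ∀ c ∈ s, ρ c = c} = (n - s.card).factorial := by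
  have e := Equiv.Perm.subtypeEquivSubtypePerm (fun c : Fin n => c ∉ s)
  have h := Fintype.card_congr e
  rw [Fintype.card_perm] at h
  have h2 : Fintype.card {c : Fin n // c ∉ s} = n - s.card := by
    rw [Fintype.card_subtype_compl]; simp
  rw [h2] at h
  rw [h]
  refine Fintype.card_congr (Equiv.subtypeEquivRight fun ρ => ?_)
  simp

open Classical in
/-- The number of pairs of permutations that agree on a set. -/
theorem card_pairs_agreeing {n : ℕ} (s : Finset (Fin n)) :
    Fintype.card {g : Bool → Equiv.Perm (Fin n) // ∀ c ∈ s, g true c = g false c}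
      = n.factorial * (n - s.card).factorial := by
  have hperm : Fintype.card (Equiv.Perm (Fin n)) = n.factorial := by
    rw [Fintype.card_perm, Fintype.card_fin]
  rw [← card_perm_fixing s, ← hperm, ← Fintype.card_prod]
  refine Fintype.card_congr
    { toFun := fun g => (g.1 true, ⟨(g.1 true)⁻¹ * g.1 false, fun c hc => ?_⟩)
      invFun := fun x => ⟨fun b => if b then x.1 else x.1 * x.2.1, fun c hc => ?_⟩
      left_inv := fun g => ?_
      right_inv := fun x => ?_ }
  · simp [← g.2 c hc]
  · simp [x.2.2 c hc]
  · ext b : 2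
    cases b <;> simp
  · simp

variable {n : ℕ}

/-- A gender word with marked edges is realised by a seating in which the marked edges join
spouses. -/
theorem IsMarking.exists_seating {w : Fin (2 * n) → Bool} {S : Finset (Fin (2 * n))}
    (h : IsMarking w S) (hw : (Finset.univ.filter fun i => w i = true).card = n) :
    ∃ σ : Fin (2 * n) ≃ Fin n × Bool, (∀ i, (σ i).2 = w i) ∧
      ∀ i ∈ S, (σ i).1 = (σ (next i)).1 := by
  classical
  have hT : Fintype.card {i // w i = true} = n := by rw [Fintype.card_subtype, hw]
  have hF : Fintype.card {i // ¬ w i = true} = n := by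
    rw [Fintype.card_subtype_compl, hT, Fintype.card_fin]; lia
  have eT : {i // w i = true} ≃ Fin n := Fintype.equivFinOfCardEq hT
  -- the other end of a marked edge is the end of gender `true` for the complementary word
  have hmem : ∀ i : S, ¬ w (trueEnd (fun j => !w j) i) = true := by
    intro i
    have := h.ne_next i i.2
    unfold trueEnd
    split_ifs with hi
    · simpa using hi
    · cases h1 : w (next i) <;> simp_all
  have hinj : Set.InjOn (trueEnd fun j => !w j) S := by
    have h' : IsMarking (fun j => !w j) S :=
      ⟨fun i => by simpa using h.alternating i, fun i hi => by simpa using h.ne_next i hi,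
        h.next_notMem⟩
    exact h'.trueEnd_injOn
  obtain ⟨eF, heF⟩ := exists_equiv_extending
    (fun i : S => (⟨trueEnd (fun j => !w j) i, hmem i⟩ : {i // ¬ w i = true}))
    (fun i : S => eT ⟨trueEnd w i, h.apply_trueEnd i.2⟩)
    (fun i j hij => Subtype.ext (hinj i.2 j.2 (congrArg Subtype.val hij)))
    (fun i j hij => Subtype.ext
      (h.trueEnd_injOn i.2 j.2 (congrArg Subtype.val (eT.injective hij))))
    (Fintype.equivFinOfCardEq hF)
  let f : Fin (2 * n) → Fin n × Bool := fun i =>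
    if hi : w i = true then (eT ⟨i, hi⟩, true) else (eF ⟨i, hi⟩, false)
  have hf : Function.Injective f := by
    intro i j hij
    simp only [f] at hij
    split_ifs at hij with hi hj hj
    · simpa using hij
    · simp at hij
    · simp at hij
    · simpa using hij
  have hb : Function.Bijective f :=
    (Fintype.bijective_iff_injective_and_card f).2 ⟨hf, by simp [mul_comm]⟩
  refine ⟨Equiv.ofBijective f hb, fun i => ?_, fun i hi => ?_⟩
  · simp only [Equiv.ofBijective_apply, f]
    split_ifs with hi <;> simp [hi]
  · have h1 := heF ⟨i, hi⟩
    have h2 := h.ne_next i hi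
    simp only [Equiv.ofBijective_apply, f]
    by_cases hwi : w i = true
    · have h3 : ¬ w (next i) = true := by rw [hwi] at h2; simpa using h2.symm
      simpa [hwi, h3, trueEnd] using h1.symm
    · have h3 : w (next i) = true := by
        cases h4 : w (next i) <;> simp_all
      simpa [hwi, h3, trueEnd] using h1

open Classical in
/-- The number of seatings with a given gender word in which the marked edges join spouses. They
differ from one such seating by a permutation of the couples for each gender, and the two
permutations agree on the couples at marked edges. -/
theorem IsMarking.card_seatings {w : Fin (2 * n) → Bool} {S : Finset (Fin (2 * n))}
    (h : IsMarking w S) (hw : (Finset.univ.filter fun i => w i = true).card = n) :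
    Fintype.card {σ : Fin (2 * n) ≃ Fin n × Bool // (∀ i, (σ i).2 = w i) ∧
      ∀ i ∈ S, (σ i).1 = (σ (next i)).1} = n.factorial * (n - S.card).factorial := by
  obtain ⟨σ₀, h1, h2⟩ := h.exists_seating hw
  have hcard : (S.image fun i => (σ₀ i).1).card = S.card := by
    apply Finset.card_image_of_injOn
    have hend : ∀ i ∈ S, σ₀ (trueEnd w i) = ((σ₀ i).1, true) := by
      intro i hi
      refine Prod.ext ?_ ((h1 _).trans (h.apply_trueEnd hi))
      unfold trueEnd
      split_ifs
      · rfl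
      · exact (h2 i hi).symm
    intro i hi j hj hij
    apply h.trueEnd_injOn hi hj
    apply σ₀.injective
    rw [hend i hi, hend j hj]
    exact congrArg (fun c => (c, true)) hij
  rw [← hcard, ← card_pairs_agreeing]
  symm
  have hiff : ∀ g : Bool → Equiv.Perm (Fin n),
      (∀ c ∈ S.image fun i => (σ₀ i).1, g true c = g false c) ↔
      ∀ i ∈ S, ((σ₀.trans (Equiv.prodCongrLeft g)) i).1
        = ((σ₀.trans (Equiv.prodCongrLeft g)) (next i)).1 := by
    intro g
    simp only [Finset.mem_image, forall_exists_index, and_imp, forall_apply_eq_imp_iff₂]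
    refine forall₂_congr fun i hi => ?_
    have e1 : σ₀ i = ((σ₀ i).1, w i) := Prod.ext rfl (h1 i)
    have e2 : σ₀ (next i) = ((σ₀ i).1, !w i) := by
      refine Prod.ext (h2 i hi).symm ((h1 _).trans ?_)
      have := h.ne_next i hi
      cases h3 : w i <;> cases h4 : w (next i) <;> simp_all
    rw [Equiv.trans_apply, Equiv.trans_apply, e2, e1]
    simp only [Equiv.prodCongrLeft_apply]
    cases w i
    · exact eq_comm
    · exact Iff.rfl
  refine Fintype.card_of_bijective
    (f := fun g => ⟨σ₀.trans (Equiv.prodCongrLeft g.1), fun i => ?_, (hiff _).1 g.2⟩) ⟨?_, ?_⟩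
  · simpa using h1 i
  · rintro ⟨g, hg⟩ ⟨g', hg'⟩ hgg
    have h3 := congrArg Subtype.val hgg
    simp only at h3
    refine Subtype.ext (funext fun b => Equiv.ext fun c => ?_)
    have := congrArg Prod.fst (Equiv.congr_fun h3 (σ₀.symm (c, b)))
    simpa using this
  · rintro ⟨σ, hσ1, hσ2⟩
    have hsnd : ∀ x, (σ (σ₀.symm x)).2 = x.2 := fun x => by rw [hσ1, ← h1]; simp
    let g : Bool → Equiv.Perm (Fin n) := fun b => Equiv.ofBijective
      (fun c => (σ (σ₀.symm (c, b))).1) (Finite.injective_iff_bijective.1 fun c c' hc => by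
        have : σ (σ₀.symm (c, b)) = σ (σ₀.symm (c', b)) :=
          Prod.ext hc ((hsnd _).trans (hsnd (c', b)).symm)
        simpa using this)
    have hg : σ₀.trans (Equiv.prodCongrLeft g) = σ := by
      ext1 i
      refine Prod.ext ?_ ?_
      · simp [g]
      · simp [h1, hσ1]
    exact ⟨⟨g, (hiff g).2 (by rw [hg]; exact hσ2)⟩, Subtype.ext hg⟩

/-- A seating has as many seats of gender `true` as there are couples. -/
theorem card_gender_true (σ : Fin (2 * n) ≃ Fin n × Bool) :
    (Finset.univ.filter fun i => (σ i).2 = true).card = n := by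
  have : (Finset.univ.filter fun i => (σ i).2 = true).card
      = (Finset.univ : Finset (Fin n)).card :=
    (Finset.card_bij (fun c _ => σ.symm (c, true)) (by simp) (by simp)
      fun i hi => ⟨(σ i).1, by simp, by
        have : (σ i).2 = true := by simpa using hi
        rw [← this]; simp⟩).symm
  simpa using this

theorem next_ne {m : ℕ} (hm : 2 ≤ m) (i : Fin m) : next i ≠ i := by
  obtain ⟨k, rfl⟩ := Nat.exists_eq_add_of_le' hm
  rw [next, finRotate_apply]
  simp

theorem next_next_ne {m : ℕ} (hm : 3 ≤ m) (i : Fin m) : next (next i) ≠ i := by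
  obtain ⟨k, rfl⟩ := Nat.exists_eq_add_of_le' hm
  rw [next, next, finRotate_apply, finRotate_apply, add_assoc]
  intro h
  have h1 : (1 + 1 : Fin (k + 3)) = 0 := by simpa using h
  simp [Fin.ext_iff, Fin.val_add, Nat.mod_eq_of_lt (show 2 < k + 3 by lia)] at h1

/-- Two spouses have different genders, and at most one neighbour of a person is the spouse. -/
theorem isMarking_of_seating (hn : 2 ≤ n) (σ : Fin (2 * n) ≃ Fin n × Bool)
    {S : Finset (Fin (2 * n))} (hS : ∀ i ∈ S, (σ i).1 = (σ (next i)).1)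
    (h : ∀ i, ¬ ((σ i).2 = (σ (next i)).2 ∧ (σ (next i)).2 = (σ (next (next i))).2)) :
    IsMarking (fun i => (σ i).2) S := by
  have hne : ∀ i ∈ S, (σ i).2 ≠ (σ (next i)).2 := fun i hi he =>
    next_ne (by lia) i (σ.injective (Prod.ext (hS i hi) he)).symm
  refine ⟨h, hne, fun i hi hi' => ?_⟩
  refine next_next_ne (by lia) i (σ.injective (Prod.ext ((hS i hi).trans (hS _ hi')) ?_)).symm
  have h1 := hne i hi
  have h2 := hne _ hi'
  revert h1 h2
  generalize (σ i).2 = a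
  generalize (σ (next i)).2 = b
  generalize (σ (next (next i))).2 = c
  cases a <;> cases b <;> cases c <;> simp

open Classical in
/-- Inclusion and exclusion over the set of edges that join spouses. For `n = 1` the two edges join
the same couple, and sets of marked edges need not be disjoint. -/
theorem T_eq_sum (hn : 2 ≤ n) :
    (T n : ℝ) = n.factorial * ∑ x : (Fin (2 * n) → Bool) × Finset (Fin (2 * n)),
      if IsMarking x.1 x.2 ∧ (Finset.univ.filter fun i => x.1 i = true).card = n then
        (-1) ^ x.2.card * ((n - x.2.card).factorial : ℝ) else 0 := by
  let alt : (Fin (2 * n) ≃ Fin n × Bool) → Prop := fun σ =>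
    ∀ i, ¬ ((σ i).2 = (σ (next i)).2 ∧ (σ (next i)).2 = (σ (next (next i))).2)
  have h1 : (T n : ℝ) = ∑ σ : Fin (2 * n) ≃ Fin n × Bool, if alt σ then
      ∏ i, (1 + -(if (σ i).1 = (σ (next i)).1 then (1 : ℝ) else 0)) else 0 := by
    rw [T, Nat.card_eq_fintype_card, Fintype.card_subtype, Finset.card_filter]
    push_cast
    refine Finset.sum_congr rfl fun σ _ => ?_
    by_cases ha : alt σ
    · by_cases hc : ∀ i, (σ i).1 ≠ (σ (next i)).1
      · rw [if_pos ⟨hc, ha⟩, if_pos ha]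
        simp [hc]
      · rw [if_neg (fun h => hc h.1), if_pos ha]
        push Not at hc
        obtain ⟨i, hi⟩ := hc
        exact (Finset.prod_eq_zero (Finset.mem_univ i) (by simp [hi])).symm
    · rw [if_neg (fun h => ha h.2), if_neg ha]
  have h2 : ∀ σ : Fin (2 * n) ≃ Fin n × Bool,
      (if alt σ then ∏ i, (1 + -(if (σ i).1 = (σ (next i)).1 then (1 : ℝ) else 0)) else 0)
      = ∑ x : (Fin (2 * n) → Bool) × Finset (Fin (2 * n)),
        if IsMarking x.1 x.2 ∧ (Finset.univ.filter fun i => x.1 i = true).card = n then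
          (-1) ^ x.2.card * (if (∀ i, (σ i).2 = x.1 i) ∧ ∀ i ∈ x.2, (σ i).1 = (σ (next i)).1
            then (1 : ℝ) else 0) else 0 := by
    intro σ
    rw [Fintype.sum_prod_type, Finset.sum_eq_single fun i => (σ i).2]
    rotate_left
    · intro w _ hw
      refine Finset.sum_eq_zero fun S _ => ?_
      have : ¬ ∀ i, (σ i).2 = w i := fun h => hw (funext fun i => (h i).symm)
      simp [this]
    · simp
    rw [Finset.prod_one_add, ← Finset.powerset_univ]
    split_ifs with ha
    · refine Finset.sum_congr rfl fun S _ => ?_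
      have hprod : ∏ i ∈ S, -(if (σ i).1 = (σ (next i)).1 then (1 : ℝ) else 0)
          = (-1) ^ S.card * if ∀ i ∈ S, (σ i).1 = (σ (next i)).1 then (1 : ℝ) else 0 := by
        rw [Finset.prod_neg, Finset.prod_ite_zero]
        simp
      rw [hprod]
      by_cases hS : ∀ i ∈ S, (σ i).1 = (σ (next i)).1
      · have := isMarking_of_seating hn σ hS ha
        simp [this, card_gender_true]
      · simp [hS]
    · refine (Finset.sum_eq_zero fun S _ => if_neg fun h => ha h.1.alternating).symm
  rw [h1, Finset.sum_congr rfl fun σ _ => h2 σ, Finset.sum_comm, Finset.mul_sum]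
  refine Finset.sum_congr rfl ?_
  rintro ⟨w, S⟩ -
  by_cases hx : IsMarking w S ∧ (Finset.univ.filter fun i => w i = true).card = n
  · simp only [hx, and_self, if_true]
    have := hx.1.card_seatings hx.2
    rw [Fintype.card_subtype, Finset.card_filter] at this
    rw [← Finset.mul_sum]
    have h3 := congrArg (Nat.cast : ℕ → ℝ) this
    push_cast at h3
    rw [h3]
    ring
  · simp only [if_neg hx, Finset.sum_const_zero, mul_zero]

end Couples

/-! ### Moments of the exponential distribution -/

section Gamma

theorem integrableOn_pow_mul_exp_neg (k : ℕ) :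
    IntegrableOn (fun t : ℝ => t ^ k * Real.exp (-t)) (Ioi 0) := by
  have h := Real.GammaIntegral_convergent (s := (k : ℝ) + 1) (by positivity)
  refine h.congr_fun (fun t _ => ?_) measurableSet_Ioi
  simp [mul_comm]

theorem integral_pow_mul_exp_neg (k : ℕ) :
    ∫ t in Ioi (0 : ℝ), t ^ k * Real.exp (-t) = k.factorial := by
  rw [← Real.Gamma_nat_eq_factorial, Real.Gamma_eq_integral (by positivity)]
  simp [mul_comm]

end Gamma

/-! ### One couple and the empty table -/

section SmallCases

theorem T_zero : T 0 = 1 := by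
  have : IsEmpty (Fin (2 * 0)) := inferInstanceAs (IsEmpty (Fin 0))
  have : Nonempty {σ : Fin (2 * 0) ≃ Fin 0 × Bool // IsTernarySeating σ} :=
    ⟨⟨Equiv.equivOfIsEmpty _ _, fun i => i.elim0, fun i => i.elim0⟩⟩
  have : Subsingleton {σ : Fin (2 * 0) ≃ Fin 0 × Bool // IsTernarySeating σ} :=
    ⟨fun σ τ => Subtype.ext (Equiv.ext fun i => i.elim0)⟩
  exact Nat.card_unique

theorem T_one : T 1 = 0 := by
  have : IsEmpty {σ : Fin (2 * 1) ≃ Fin 1 × Bool // IsTernarySeating σ} :=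
    ⟨fun σ => σ.2.1 0 (Subsingleton.elim _ _)⟩
  exact Nat.card_of_isEmpty

theorem trace_transfer_sq {R : Type*} [CommRing R] (t u v : R) :
    (transfer t u v ^ 2).trace = (2 * t - 4) * (u * v) := by
  rw [pow_two]
  simp only [Matrix.trace, Matrix.diag, Matrix.mul_apply, Fintype.sum_prod_type,
    Fintype.sum_bool, Fin.sum_univ_three]
  simp [transfer]
  ring

variable {K : Type*} [CommRing K]

open LaurentPolynomial in
theorem coeff_C_zero (k : K) : (LaurentPolynomial.C k : K[T;T⁻¹]).coeff 0 = k := by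
  change (AddMonoidAlgebra.single (0 : ℤ) k).coeff 0 = _
  rw [AddMonoidAlgebra.coeff_single, Finsupp.single_eq_same]

open LaurentPolynomial in
theorem markedCount_zero (t : K) : markedCount t 0 = 6 := by
  have : (6 : K[T;T⁻¹]) = LaurentPolynomial.C 6 := (map_ofNat _ 6).symm
  rw [markedCount, mul_zero, pow_zero, Matrix.trace_one]
  simp [this]

open LaurentPolynomial in
theorem markedCount_one (t : K) : markedCount t 1 = 2 * t - 4 := by
  rw [markedCount, mul_one, trace_transfer_sq, ← LaurentPolynomial.T_add]
  have : (2 * LaurentPolynomial.C t - 4 : K[T;T⁻¹]) = LaurentPolynomial.C (2 * t - 4) := by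
    simp [map_ofNat]
  rw [this, add_neg_cancel, LaurentPolynomial.T_zero, mul_one, coeff_C_zero]

end SmallCases

/-! ### The integral of the weighted counts -/

section Moments

theorem map_markedCount {K L : Type*} [CommRing K] [CommRing L] (f : K →+* L) (t : K) (n : ℕ) :
    f (markedCount t n) = markedCount (f t) n := by
  classical
  rcases eq_or_ne n 0 with rfl | hn
  · rw [markedCount_zero, markedCount_zero, map_ofNat]
  · rw [markedCount_eq_sum _ hn, markedCount_eq_sum _ hn, map_sum]
    refine Finset.sum_congr rfl fun x _ => ?_
    split_ifs <;> simp

theorem integrableOn_polynomial_mul_exp_neg (P : Polynomial ℝ) :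
    IntegrableOn (fun t : ℝ => P.eval t * Real.exp (-t)) (Ioi 0) := by
  simp only [Polynomial.eval_eq_sum_range, Finset.sum_mul]
  refine integrable_finsetSum _ fun k _ => ?_
  simp only [mul_assoc]
  exact (integrableOn_pow_mul_exp_neg k).const_mul _

theorem eval_markedCount (t : ℝ) (n : ℕ) :
    (markedCount (Polynomial.X : Polynomial ℝ) n).eval t = markedCount t n := by
  have := map_markedCount (Polynomial.evalRingHom t) Polynomial.X n
  simpa using this

theorem integrableOn_markedCount (n : ℕ) :
    IntegrableOn (fun t : ℝ => markedCount t n * Real.exp (-t)) (Ioi 0) := by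
  simpa only [eval_markedCount] using
    integrableOn_polynomial_mul_exp_neg (markedCount (Polynomial.X : Polynomial ℝ) n)

/-- Integration against `e⁻ᵗ` turns the weight `tᵏ` of `k` free couples into the number `k!` of
ways to place them. -/
theorem T_div_factorial {n : ℕ} (hn : 2 ≤ n) :
    (T n : ℝ) / n.factorial = ∫ t in Ioi (0 : ℝ), markedCount t n * Real.exp (-t) := by
  classical
  rw [T_eq_sum hn, mul_div_cancel_left₀ _ (by positivity)]
  simp only [markedCount_eq_sum _ (show n ≠ 0 by lia), Finset.sum_mul]
  rw [integral_finsetSum]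
  · refine Finset.sum_congr rfl fun x _ => ?_
    split_ifs
    · simp only [mul_assoc]
      rw [integral_const_mul, integral_pow_mul_exp_neg]
    · simp
  · intro x _
    split_ifs
    · simp only [mul_assoc]
      exact (integrableOn_pow_mul_exp_neg _).const_mul _
    · simp

end Moments

/-! ### The formal integrands -/

section FormalIntegrands

theorem sqrt_unique {K : Type*} [CommRing K] [IsDomain K] [CharZero K] {f g : K⟦X⟧}
    (h : f * f = g * g) (hf : constantCoeff f = 1) (hg : constantCoeff g = 1) : f = g := by
  have h1 : (f - g) * (f + g) = 0 := by linear_combination h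
  rcases mul_eq_zero.1 h1 with h2 | h2
  · exact sub_eq_zero.1 h2
  · have := congrArg constantCoeff h2
    rw [map_add, hf, hg, map_zero, one_add_one_eq_two] at this
    exact absurd this two_ne_zero

theorem constantCoeff_egfRad {K : Type*} [CommRing K] (t : K) :
    constantCoeff (egfRad X (PowerSeries.C t)) = 1 := by
  simp [egfRad]

theorem coe_injective : Function.Injective (fun f : ℝ⟦X⟧ => (f : ℝ⸨X⸩)) :=
  HahnSeries.ofPowerSeries_injective

theorem coe_ne_zero {f : ℝ⟦X⟧} (hf : f ≠ 0) : (f : ℝ⸨X⸩) ≠ 0 := fun h =>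
  hf (coe_injective (h.trans PowerSeries.coe_zero.symm))

theorem C_sub_X_add_two_ne_zero {K : Type*} [CommRing K] [Nontrivial K] (t : K) :
    PowerSeries.C t - (X + 2) ≠ 0 := by
  intro h
  have := congrArg (coeff 1) h
  have h2 : (2 : K⟦X⟧) = PowerSeries.C 2 := (map_ofNat PowerSeries.C 2).symm
  rw [h2] at this
  simp at this

theorem ne_zero_of_constantCoeff_eq_one {f : ℝ⟦X⟧} (hf : constantCoeff f = 1) : f ≠ 0 := by
  rintro rfl
  simp at hf

theorem markedSeries_mul_psSqrt (t : ℝ) :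
    (PowerSeries.C t - (X + 2)) * (markedSeries t - 3) * psSqrt (egfRad X (PowerSeries.C t))
      = egfNum X (PowerSeries.C t) + 2 * X * psSqrt (egfRad X (PowerSeries.C t)) :=
  markedSeries_mul_sqrt t _ (psSqrt_mul_self _ (constantCoeff_egfRad t))
    (constantCoeff_psSqrt _ (constantCoeff_egfRad t))

theorem egfSeries_eq (t : ℝ) : egfSeries t = ((markedSeries t - 3 : ℝ⟦X⟧) : ℝ⸨X⸩) := by
  have hs := constantCoeff_psSqrt _ (constantCoeff_egfRad t)
  have key := markedSeries_mul_psSqrt t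
  set s := psSqrt (egfRad X (PowerSeries.C t)) with hs_def
  have h1 : (((PowerSeries.C t - (X + 2)) : ℝ⟦X⟧) : ℝ⸨X⸩) ≠ 0 :=
    coe_ne_zero (C_sub_X_add_two_ne_zero t)
  have h2 : (s : ℝ⸨X⸩) ≠ 0 := coe_ne_zero (ne_zero_of_constantCoeff_eq_one hs)
  have h3 : ((PowerSeries.C t - (X + 2) : ℝ⟦X⟧) : ℝ⸨X⸩)
      + ((X + 2 - PowerSeries.C t : ℝ⟦X⟧) : ℝ⸨X⸩) = 0 := by
    rw [← PowerSeries.coe_add, ← PowerSeries.coe_zero]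
    congr 1
    ring
  have h4 : ((X + 2 - PowerSeries.C t : ℝ⟦X⟧) : ℝ⸨X⸩) ≠ 0 := by
    intro h
    rw [h, add_zero] at h3
    exact h1 h3
  have key' := congrArg (fun f : ℝ⟦X⟧ => (f : ℝ⸨X⸩)) key
  simp only [PowerSeries.coe_mul, PowerSeries.coe_add] at key'
  unfold egfSeries
  simp only
  rw [← hs_def, PowerSeries.coe_mul (_ - _) s, div_sub_div _ _ (mul_ne_zero h1 h2) h4,
    div_eq_iff (mul_ne_zero (mul_ne_zero h1 h2) h4)]
  simp only [PowerSeries.coe_mul]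
  linear_combination -((X + 2 - PowerSeries.C t : ℝ⟦X⟧) : ℝ⸨X⸩) * key'
    - ((2 : ℝ⟦X⟧) : ℝ⸨X⸩) * ((X : ℝ⟦X⟧) : ℝ⸨X⸩) * (s : ℝ⸨X⸩) * h3

/-- The radicand of the first formula is that of the second one times a square: `c + 2 p d` is
`egfRad`, and `c - 2 p d` is a perfect square. -/
theorem coeffSeries_radicand (t : ℝ) :
    psSqrt (c X (PowerSeries.C t) ^ 2 - 4 * X ^ 2 * d X (PowerSeries.C t) ^ 2)
      = (1 - (PowerSeries.C t - 2) * X - X ^ 2 * (PowerSeries.C t ^ 2 - 2 * PowerSeries.C t)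
          + PowerSeries.C t * X ^ 3) * psSqrt (egfRad X (PowerSeries.C t)) := by
  have h0 : constantCoeff (c X (PowerSeries.C t) ^ 2
      - 4 * X ^ 2 * d X (PowerSeries.C t) ^ 2 : ℝ⟦X⟧) = 1 := by
    simp [c]
  refine sqrt_unique ?_ (constantCoeff_psSqrt _ h0) ?_
  · rw [psSqrt_mul_self _ h0, mul_mul_mul_comm, psSqrt_mul_self _ (constantCoeff_egfRad t)]
    unfold c d egfRad
    ring
  · rw [map_mul, constantCoeff_psSqrt _ (constantCoeff_egfRad t)]
    simp

theorem d_ne_zero {t : ℝ} (ht : t ≠ 0) : (d X (PowerSeries.C t) : ℝ⟦X⟧) ≠ 0 := by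
  unfold d
  have h : (2 + X - PowerSeries.C t : ℝ⟦X⟧) ≠ 0 := by
    have := C_sub_X_add_two_ne_zero t
    intro h; apply this; linear_combination -h
  have hC : (PowerSeries.C t : ℝ⟦X⟧) ≠ 0 := by simpa using ht
  exact neg_ne_zero.2 (mul_ne_zero (mul_ne_zero (pow_ne_zero _ X_ne_zero) hC) (pow_ne_zero _ h))

theorem coeffSeries_eq {t : ℝ} (ht : t ≠ 0) : coeffSeries t = (markedSeries t : ℝ⸨X⸩) := by
  have hs := constantCoeff_psSqrt _ (constantCoeff_egfRad t)
  have key := markedSeries_mul_psSqrt t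
  unfold coeffSeries
  simp only
  rw [coeffSeries_radicand]
  set s := psSqrt (egfRad X (PowerSeries.C t)) with hs_def
  set c₀ : ℝ⟦X⟧ := 1 - (PowerSeries.C t - 2) * X
    - X ^ 2 * (PowerSeries.C t ^ 2 - 2 * PowerSeries.C t) + PowerSeries.C t * X ^ 3 with hc₀
  have h1 : ((d X (PowerSeries.C t) : ℝ⟦X⟧) : ℝ⸨X⸩) ≠ 0 := coe_ne_zero (d_ne_zero ht)
  have h2 : ((c₀ * s : ℝ⟦X⟧) : ℝ⸨X⸩) ≠ 0 := by
    refine coe_ne_zero (ne_zero_of_constantCoeff_eq_one ?_)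
    rw [map_mul, hs, hc₀]; simp
  have main : (a X (PowerSeries.C t) * d X (PowerSeries.C t)
        - b X (PowerSeries.C t) * c X (PowerSeries.C t)) + b X (PowerSeries.C t) * (c₀ * s)
      = markedSeries t * (d X (PowerSeries.C t) * (c₀ * s)) := by
    have e1 : (a X (PowerSeries.C t) * d X (PowerSeries.C t)
        - b X (PowerSeries.C t) * c X (PowerSeries.C t) : ℝ⟦X⟧)
        = X ^ 2 * PowerSeries.C t * (2 + X - PowerSeries.C t) * c₀ * egfNum X (PowerSeries.C t) := by
      rw [hc₀]; unfold a b c d egfNum; ring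
    rw [e1]
    simp only [b, d]
    linear_combination -(X ^ 2 * PowerSeries.C t * (2 + X - PowerSeries.C t) * c₀) * key
  have main' := congrArg (fun f : ℝ⟦X⟧ => (f : ℝ⸨X⸩)) main
  beta_reduce at main'
  rw [PowerSeries.coe_mul (d _ _), div_add_div _ _ (mul_ne_zero h1 h2) h1,
    div_eq_iff (mul_ne_zero (mul_ne_zero h1 h2) h1)]
  rw [PowerSeries.coe_add, PowerSeries.coe_mul (b _ _) (c₀ * s), PowerSeries.coe_mul (markedSeries t),
    PowerSeries.coe_mul (d _ _)] at main'
  linear_combination ((d X (PowerSeries.C t) : ℝ⟦X⟧) : ℝ⸨X⸩) * main'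

theorem coeff_coeffSeries {t : ℝ} (ht : t ≠ 0) (n : ℕ) :
    (coeffSeries t).coeff (n : ℤ) = markedCount t n := by
  rw [coeffSeries_eq ht, LaurentSeries.coeff_coe_powerSeries, markedSeries, coeff_mk]

theorem coeff_egfSeries (t : ℝ) (n : ℕ) :
    (egfSeries t).coeff (n : ℤ) = markedCount t n - if n = 0 then 3 else 0 := by
  have h3 : (3 : ℝ⟦X⟧) = PowerSeries.C 3 := (map_ofNat PowerSeries.C 3).symm
  rw [egfSeries_eq, LaurentSeries.coeff_coe_powerSeries, map_sub, markedSeries, coeff_mk, h3,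
    PowerSeries.coeff_C]

theorem T_integral_formula (n : ℕ) (hn : 1 < n) :
    IntegrableOn (fun t : ℝ => (coeffSeries t).coeff (n : ℤ) * Real.exp (-t)) (Ioi 0) ∧
      (T n : ℝ) = (n.factorial : ℝ) *
        ∫ t in Ioi (0 : ℝ), (coeffSeries t).coeff (n : ℤ) * Real.exp (-t) := by
  have h : EqOn (fun t : ℝ => markedCount t n * Real.exp (-t))
      (fun t : ℝ => (coeffSeries t).coeff (n : ℤ) * Real.exp (-t)) (Ioi 0) := fun t ht => by
    simp only [coeff_coeffSeries (ne_of_gt ht)]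
  refine ⟨(integrableOn_markedCount n).congr_fun h measurableSet_Ioi, ?_⟩
  rw [← setIntegral_congr_fun measurableSet_Ioi h, ← T_div_factorial hn]
  field_simp

/-- The terms `-2 + 2 x` and the subtracted constant `3` correct the coefficients of order `0` and
`1`, where the weighted counts `6` and `2 t - 4` have the integrals `6` and `-2`, but `T 0 = 1` and
`T 1 = 0`. -/
theorem egf_integral_formula (n : ℕ) :
    IntegrableOn (fun t : ℝ => (egfSeries t).coeff (n : ℤ) * Real.exp (-t)) (Ioi 0) ∧
      PowerSeries.coeff n egf = PowerSeries.coeff n (-2 + 2 * PowerSeries.X : PowerSeries ℝ) +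
        ∫ t in Ioi (0 : ℝ), (egfSeries t).coeff (n : ℤ) * Real.exp (-t) := by
  have h2 : (2 : ℝ⟦X⟧) = PowerSeries.C 2 := (map_ofNat PowerSeries.C 2).symm
  have hexp := integral_pow_mul_exp_neg 0
  have hid := integral_pow_mul_exp_neg 1
  have hexp' := integrableOn_pow_mul_exp_neg 0
  have hid' := integrableOn_pow_mul_exp_neg 1
  simp only [pow_zero, pow_one, one_mul, Nat.factorial_zero, Nat.factorial_one, Nat.cast_one]
    at hexp hid hexp' hid'
  simp only [coeff_egfSeries]
  constructor
  · simp only [sub_mul]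
    exact (integrableOn_markedCount n).sub (hexp'.const_mul _)
  · rw [egf, coeff_mk, h2, map_add, ← map_neg, PowerSeries.coeff_C, PowerSeries.coeff_C_mul,
      PowerSeries.coeff_X]
    obtain rfl | rfl | hn : n = 0 ∨ n = 1 ∨ 2 ≤ n := by lia
    · simp only [markedCount_zero, T_zero, if_true, integral_const_mul, hexp]
      norm_num
    · have e : ∀ t : ℝ, (2 * t - 4 - 0) * Real.exp (-t)
          = 2 * (t * Real.exp (-t)) - 4 * Real.exp (-t) := fun t => by ring
      simp only [markedCount_one, T_one, if_neg one_ne_zero, e]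
      rw [integral_sub (hid'.const_mul 2) (hexp'.const_mul 4), integral_const_mul,
        integral_const_mul, hexp, hid]
      norm_num
    · have h0 : n ≠ 0 := by lia
      have h1 : n ≠ 1 := by lia
      simp only [h0, h1, if_false, sub_zero, mul_zero, zero_add]
      exact T_div_factorial hn

end FormalIntegrands

/-! ### Principal values and the exponential integral -/

section PrincipalValues

variable {E F : Type*} [NormedAddCommGroup E] [NormedSpace ℝ E] [NormedAddCommGroup F]
  [NormedSpace ℝ F] {S : Set ℝ} {f g : ℝ → E} {s : ℝ} {l l' : E}

theorem HasPV.pv_eq (h : HasPV S f s l) : pv S f s = l := h.2.limUnder_eq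

theorem HasPV.add (hf : HasPV S f s l) (hg : HasPV S g s l') :
    HasPV S (fun t => f t + g t) s (l + l') := by
  refine ⟨fun ε hε => (hf.1 ε hε).add (hg.1 ε hε), (hf.2.add hg.2).congr' ?_⟩
  filter_upwards [self_mem_nhdsWithin] with ε hε
  exact (integral_add (hf.1 ε hε) (hg.1 ε hε)).symm

theorem HasPV.clm_comp [CompleteSpace E] [CompleteSpace F] (L : E →L[ℝ] F) (hf : HasPV S f s l) :
    HasPV S (fun t => L (f t)) s (L l) := by
  refine ⟨fun ε hε => L.integrable_comp (hf.1 ε hε),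
    ((L.continuous.tendsto l).comp hf.2).congr' ?_⟩
  filter_upwards [self_mem_nhdsWithin] with ε hε
  exact (L.integral_comp_comm (hf.1 ε hε)).symm

theorem HasPV.congr_ae (hS : MeasurableSet S) (hf : HasPV S f s l)
    (h : ∀ᵐ t, t ∈ S → f t = g t) : HasPV S g s l := by
  have key : ∀ ε, f =ᵐ[volume.restrict (S \ Ioo (s - ε) (s + ε))] g := fun ε => by
    filter_upwards [ae_restrict_mem (hS.diff measurableSet_Ioo), ae_restrict_of_ae h] with t ht h1
    exact h1 ht.1
  exact ⟨fun ε hε => (hf.1 ε hε).congr (key ε), hf.2.congr fun ε => integral_congr_ae (key ε)⟩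

/-- The principal value of an integrable function is its integral. -/
theorem HasPV.of_integrableOn (hS : MeasurableSet S) (hf : IntegrableOn f S) (s : ℝ) :
    HasPV S f s (∫ t in S, f t) := by
  refine ⟨fun ε _ => hf.mono_set sdiff_subset, ?_⟩
  have hset : ∀ ε, MeasurableSet (S \ Ioo (s - ε) (s + ε)) := fun ε => hS.diff measurableSet_Ioo
  simp only [← integral_indicator (hset _), ← integral_indicator hS]
  refine tendsto_integral_filter_of_dominated_convergence (fun t => ‖S.indicator f t‖) ?_ ?_ ?_ ?_
  · exact Eventually.of_forall fun ε =>
      ((integrable_indicator_iff (hset ε)).2 (hf.mono_set sdiff_subset)).aestronglyMeasurable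
  · refine Eventually.of_forall fun ε => Eventually.of_forall fun t => ?_
    by_cases ht : t ∈ S \ Ioo (s - ε) (s + ε)
    · rw [indicator_of_mem ht, indicator_of_mem ht.1]
    · rw [indicator_of_notMem ht, norm_zero]
      exact norm_nonneg _
  · exact ((integrable_indicator_iff hS).2 hf).norm
  · have : ∀ᵐ t : ℝ, t ≠ s := by simp [ae_iff]
    filter_upwards [this] with t ht
    refine tendsto_const_nhds.congr' ?_
    have hpos : 0 < |t - s| := abs_pos.2 (sub_ne_zero.2 ht)
    filter_upwards [Ioo_mem_nhdsGT hpos] with ε hε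
    have hmem : t ∉ Ioo (s - ε) (s + ε) := by
      rintro ⟨h1, h2⟩
      have h3 : |t - s| < ε := abs_lt.2 ⟨by linarith, by linarith⟩
      exact absurd h3 (not_lt.2 hε.2.le)
    by_cases hS' : t ∈ S
    · rw [indicator_of_mem hS', indicator_of_mem
        (show t ∈ S \ Ioo (s - ε) (s + ε) from ⟨hS', hmem⟩)]
    · rw [indicator_of_notMem hS', indicator_of_notMem fun h => hS' h.1]

theorem HasPV.comp_sub (s : ℝ) (h : HasPV S f 0 l) :
    HasPV ((fun t => t - s) ⁻¹' S) (fun t => f (t - s)) s l := by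
  have hmp := measurePreserving_sub_right (volume : Measure ℝ) s
  have hemb : MeasurableEmbedding fun t : ℝ => t - s := (Homeomorph.subRight s).measurableEmbedding
  have hset : ∀ ε, (fun t => t - s) ⁻¹' S \ Ioo (s - ε) (s + ε)
      = (fun t => t - s) ⁻¹' (S \ Ioo (0 - ε) (0 + ε)) := fun ε => by
    ext t
    simp only [Set.mem_sdiff, mem_preimage, mem_Ioo, not_and, not_lt]
    refine and_congr_right fun _ => ?_
    constructor <;> intro h h' <;> linarith [h (by linarith)]
  refine ⟨fun ε hε => ?_, h.2.congr fun ε => ?_⟩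
  · rw [hset]
    exact (hmp.integrableOn_comp_preimage hemb).2 (h.1 ε hε)
  · rw [hset]
    exact (hmp.setIntegral_preimage_emb hemb f _).symm

/-- The principal value of `1 / u` over a symmetric interval vanishes. -/
theorem hasPV_inv_indicator {r : ℝ} (hS : MeasurableSet S) (hr : Ioo (-r) r ⊆ S) :
    HasPV S ((Ioo (-r) r).indicator fun u : ℝ => u⁻¹) 0 0 := by
  have hint : ∀ ε > 0, IntegrableOn ((Ioo (-r) r).indicator fun u : ℝ => u⁻¹)
      (S \ Ioo (0 - ε) (0 + ε)) := by
    intro ε hε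
    have hdom : IntegrableOn ((Ioo (-r) r).indicator fun _ : ℝ => ε⁻¹)
        (S \ Ioo (0 - ε) (0 + ε)) := by
      refine Integrable.integrableOn ?_
      rw [integrable_indicator_iff measurableSet_Ioo]
      exact integrableOn_const (by simp)
    refine Integrable.mono' hdom
      ((measurable_inv.indicator measurableSet_Ioo).aestronglyMeasurable) ?_
    filter_upwards [ae_restrict_mem (hS.diff measurableSet_Ioo)] with u hu
    by_cases hu' : u ∈ Ioo (-r) r
    · rw [indicator_of_mem hu', indicator_of_mem hu', norm_inv]
      refine inv_anti₀ hε ?_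
      rw [Real.norm_eq_abs]
      by_contra hc
      exact hu.2 ⟨by linarith [(abs_lt.1 (not_le.1 hc)).1], by linarith [(abs_lt.1 (not_le.1 hc)).2]⟩
    · rw [indicator_of_notMem hu', indicator_of_notMem hu', norm_zero]
  refine ⟨hint, tendsto_const_nhds.congr fun ε => ?_⟩
  rw [← integral_indicator (hS.diff measurableSet_Ioo), indicator_indicator]
  set A : Set ℝ := S \ Ioo (0 - ε) (0 + ε) ∩ Ioo (-r) r with hA
  have hsymm : ∀ u, A.indicator (fun u : ℝ => u⁻¹) (-u) = -A.indicator (fun u : ℝ => u⁻¹) u := by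
    intro u
    have hmem : ∀ v, v ∈ A → -v ∈ A := by
      rintro v ⟨⟨_, h1⟩, h2⟩
      have h3 : -v ∈ Ioo (-r) r := ⟨by linarith [h2.2], by linarith [h2.1]⟩
      exact ⟨⟨hr h3, fun h => h1 ⟨by linarith [h.2], by linarith [h.1]⟩⟩, h3⟩
    by_cases hu : u ∈ A
    · rw [indicator_of_mem hu, indicator_of_mem (hmem u hu), inv_neg]
    · rw [indicator_of_notMem hu, indicator_of_notMem fun h => hu (by simpa using hmem _ h),
        neg_zero]
  have h1 := integral_neg_eq_self (A.indicator fun u : ℝ => u⁻¹) volume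
  simp only [hsymm, integral_neg] at h1
  linarith

/-- The principal value defining the exponential integral exists. -/
theorem hasPV_exp_neg_div {r : ℝ} (hr : 0 < r) :
    HasPV (Ioi (-r)) (fun u : ℝ => Real.exp (-u) / u) 0 (-Ei r) := by
  have hexp : IntegrableOn (fun u : ℝ => Real.exp (-u)) (Ioi (-r)) := by
    simpa using exp_neg_integrableOn_Ioi (-r) one_pos
  have hsub : Ioo (-r) r ⊆ Ioi (-r) := fun u hu => hu.1
  -- off the singularity `1 / u` the integrand is the integrable function `h`
  let h : ℝ → ℝ := fun u => Real.exp (-u) / u - (Ioo (-r) r).indicator (fun u : ℝ => u⁻¹) u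
  have hmeas : Measurable h := by
    refine Measurable.sub ?_ (measurable_inv.indicator measurableSet_Ioo)
    fun_prop
  have hint : IntegrableOn h (Ioi (-r)) := by
    have hdom : IntegrableOn (fun u : ℝ => r⁻¹ * Real.exp (-u)
        + (Ioo (-r) r).indicator (fun _ => Real.exp r) u) (Ioi (-r)) := by
      refine (hexp.const_mul _).add (Integrable.integrableOn ?_)
      rw [integrable_indicator_iff measurableSet_Ioo]
      exact integrableOn_const (by simp)
    refine Integrable.mono' hdom hmeas.aestronglyMeasurable ?_
    filter_upwards [ae_restrict_mem measurableSet_Ioi] with u hu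
    by_cases hu' : u ∈ Ioo (-r) r
    · simp only [h, indicator_of_mem hu']
      have hpos : 0 ≤ r⁻¹ * Real.exp (-u) := by positivity
      rcases eq_or_ne u 0 with rfl | h0
      · simp only [div_zero, inv_zero, sub_zero, norm_zero]
        positivity
      have e : Real.exp (-u) / u - u⁻¹ = (Real.exp (-u) - 1) / u := by field_simp
      rw [e, norm_div, Real.norm_eq_abs, Real.norm_eq_abs]
      have hb : |Real.exp (-u) - 1| ≤ |u| * Real.exp r := by
        have h1 : 1 - u ≤ Real.exp (-u) := by linarith [Real.add_one_le_exp (-u)]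
        have h2 : 1 + u ≤ Real.exp u := by linarith [Real.add_one_le_exp u]
        have h3 : Real.exp u * Real.exp (-u) = 1 := by rw [← Real.exp_add]; simp
        have h4 : Real.exp (-u) ≤ Real.exp r := Real.exp_le_exp.2 (by linarith [hu'.1])
        have h5 : 1 ≤ Real.exp r := Real.one_le_exp hr.le
        rcases le_total 0 u with hu0 | hu0
        · rw [abs_of_nonneg hu0, abs_le]
          constructor
          · nlinarith
          · have : Real.exp (-u) ≤ 1 := Real.exp_le_one_iff.2 (by linarith)
            nlinarith
        · rw [abs_of_nonpos hu0, abs_le]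
          have : 1 ≤ Real.exp (-u) := Real.one_le_exp (by linarith)
          constructor
          · nlinarith
          · nlinarith [Real.exp_pos (-u)]
      calc |Real.exp (-u) - 1| / |u| ≤ Real.exp r := by
            rw [div_le_iff₀ (abs_pos.2 h0), mul_comm]; exact hb
        _ ≤ _ := by linarith
    · simp only [h, indicator_of_notMem hu', sub_zero, add_zero]
      have hur : r ≤ u := by
        by_contra hc
        exact hu' ⟨hu, not_le.1 hc⟩
      rw [norm_div, Real.norm_eq_abs, Real.norm_eq_abs, abs_of_pos (Real.exp_pos _),
        abs_of_pos (by linarith), div_eq_mul_inv, mul_comm]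
      gcongr
  have hpv := (HasPV.of_integrableOn measurableSet_Ioi hint 0).add
    (hasPV_inv_indicator measurableSet_Ioi hsub)
  simp only [h, sub_add_cancel] at hpv
  rw [Ei, neg_neg, hpv.pv_eq]
  exact hpv

/-- The substitution `t = u + x + 2` in the exponential integral. -/
theorem hasPV_exp_neg_div_sub {x : ℝ} (hx : -2 < x) :
    HasPV (Ioi 0) (fun t : ℝ => Real.exp (-t) / (x + 2 - t)) (x + 2)
      (Real.exp (-x - 2) * Ei (x + 2)) := by
  have h1 := (hasPV_exp_neg_div (r := x + 2) (by linarith)).clm_comp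
    (-Real.exp (-x - 2) • ContinuousLinearMap.id ℝ ℝ)
  have h2 := HasPV.comp_sub (x + 2) h1
  have hset : (fun t : ℝ => t - (x + 2)) ⁻¹' Ioi (-(x + 2)) = Ioi 0 := by
    ext t; simp
  rw [hset] at h2
  simp only [smul_apply, ContinuousLinearMap.id_apply, smul_eq_mul,
    neg_mul_neg] at h2
  refine h2.congr_ae measurableSet_Ioi (Eventually.of_forall fun t _ => ?_)
  have e : Real.exp (-t) = Real.exp (-x - 2) * Real.exp (-(t - (x + 2))) := by
    rw [← Real.exp_add]; congr 1; ring
  rw [e, ← neg_sub t (x + 2), div_neg, neg_mul, mul_div_assoc]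

end PrincipalValues

/-! ### Truncated algebraic equations -/

section Truncation

/-- At `t = x + 2` the polynomial `egfNum x t` has the value `-2 x (1 - x²)`; this is the quotient of
`egfNum x t + 2 x (1 - x²)` by `t - (x + 2)`. -/
def numQuot {R : Type*} [CommRing R] (x t : R) : R :=
  3 + 2 * x - x * t + 2 * x ^ 2 - 2 * x ^ 2 * t + x ^ 2 * t ^ 2 - x ^ 3 * t

/-- The quotient of `egfRad x t - (1 - x²)²` by `t - (x + 2)`. -/
def radQuot {R : Type*} [CommRing R] (x t : R) : R :=
  -2 * x - 2 * x ^ 2 - x ^ 2 * t + x ^ 3 + 4 * x ^ 3 * t - 2 * x ^ 3 * t ^ 2 + 4 * x ^ 4 * t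
    - 2 * x ^ 4 * t ^ 2 + x ^ 4 * t ^ 3 - x ^ 5 * t ^ 2

theorem egfNum_add {R : Type*} [CommRing R] (x t : R) :
    egfNum x t + 2 * x * (1 - x ^ 2) = (t - (x + 2)) * numQuot x t := by
  unfold egfNum numQuot; ring

theorem egfRad_sub {R : Type*} [CommRing R] (x t : R) :
    egfRad x t - (1 - x ^ 2) ^ 2 = (t - (x + 2)) * radQuot x t := by
  unfold egfRad radQuot; ring

/-- The binomial series gives square roots over every `ℝ`-algebra, in particular over `ℝ[t]`. -/
theorem exists_sqrt {A : Type*} [CommRing A] [Algebra ℝ A] (f : A⟦X⟧)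
    (hf : constantCoeff f = 1) : ∃ s : A⟦X⟧, s * s = f ∧ constantCoeff s = 1 := by
  have h0 : constantCoeff (f - 1) = 0 := by simp [hf]
  have h : HasSubst (f - 1) := HasSubst.of_constantCoeff_zero' h0
  have e : PowerSeries.binomialSeries A (1 / 2 : ℝ) = 1 + X * PowerSeries.mk fun n =>
      coeff (n + 1) (PowerSeries.binomialSeries A (1 / 2 : ℝ)) := by
    rw [← sub_eq_iff_eq_add']
    have := sub_const_eq_X_mul_shift (PowerSeries.binomialSeries A (1 / 2 : ℝ))
    simpa using this
  refine ⟨(PowerSeries.binomialSeries A (1 / 2 : ℝ)).subst (f - 1), ?_, ?_⟩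
  · rw [← subst_mul h, ← binomialSeries_add, add_halves]
    have := binomialSeries_nat (R := ℝ) (A := A) 1
    rw [Nat.cast_one, pow_one] at this
    rw [this, subst_add h, subst_X h, ← coe_substAlgHom h, map_one]
    ring
  · rw [e, subst_add h, subst_mul h, subst_X h, ← coe_substAlgHom h, map_one]
    simp [hf]

theorem X_pow_dvd_trunc_sub {A : Type*} [CommRing A] (M : ℕ) (f : A⟦X⟧) :
    X ^ M ∣ ((trunc M f : Polynomial A) : A⟦X⟧) - f := by
  rw [PowerSeries.X_pow_dvd_iff]
  intro m hm
  rw [map_sub, Polynomial.coeff_coe, coeff_trunc, if_pos hm, sub_self]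

theorem X_pow_dvd_of_coe {A : Type*} [CommRing A] {M : ℕ} {p : Polynomial A}
    (h : X ^ M ∣ (p : A⟦X⟧)) : Polynomial.X ^ M ∣ p := by
  rw [PowerSeries.X_pow_dvd_iff] at h
  rw [Polynomial.X_pow_dvd_iff]
  intro m hm
  rw [← Polynomial.coeff_coe, h m hm]

/-- The generating series of the weighted counts over `ℝ[t]`, truncated at order `M`. -/
def markedTrunc (M : ℕ) : Polynomial (Polynomial ℝ) :=
  trunc M (markedSeries (Polynomial.X : Polynomial ℝ) - 3)

/-- The variable `t` as a polynomial in `x` with coefficients in `ℝ[t]`. -/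
abbrev bivT : Polynomial (Polynomial ℝ) := Polynomial.C Polynomial.X

/-- The truncations of `√egfRad` and of the generating series satisfy their algebraic equations up to
multiples of `x^M` whose coefficients are polynomials in `t`. The last equation is that of the
regular part of the integrand, in which the pole at `t = x + 2` has been cancelled. -/
theorem exists_truncated_equations {M : ℕ} (hM : M ≠ 0) :
    ∃ S S' E E' : Polynomial (Polynomial ℝ),
      S - 1 = Polynomial.X * S' ∧
      S * S - egfRad Polynomial.X bivT = Polynomial.X ^ M * E' ∧
      markedTrunc M * S * (S + (1 - Polynomial.X ^ 2))
        - (numQuot Polynomial.X bivT * (S + (1 - Polynomial.X ^ 2))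
          + 2 * Polynomial.X * radQuot Polynomial.X bivT)
        = Polynomial.X ^ M * E := by
  set t : (Polynomial ℝ)⟦X⟧ := PowerSeries.C Polynomial.X with ht
  obtain ⟨s, hs, hs0⟩ := exists_sqrt (egfRad X t) (constantCoeff_egfRad _)
  have h2 : Invertible (2 : Polynomial ℝ) :=
    ⟨Polynomial.C (1 / 2), by
      rw [show (2 : Polynomial ℝ) = Polynomial.C 2 from rfl, ← map_mul]; norm_num, by
      rw [show (2 : Polynomial ℝ) = Polynomial.C 2 from rfl, ← map_mul]; norm_num⟩
  have key := markedSeries_mul_sqrt (Polynomial.X : Polynomial ℝ) s hs hs0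
  rw [← ht] at key
  set W : (Polynomial ℝ)⟦X⟧ := markedSeries Polynomial.X - 3 with hW
  -- the pole at `t = x + 2` cancels
  have hreg : W * s * (s + (1 - X ^ 2)) = numQuot X t * (s + (1 - X ^ 2)) + 2 * X * radQuot X t := by
    refine mul_left_cancel₀ (C_sub_X_add_two_ne_zero (Polynomial.X : Polynomial ℝ)) ?_
    rw [← ht]
    linear_combination (s + (1 - X ^ 2)) * key + (s + (1 - X ^ 2)) * egfNum_add X t
      + 2 * X * egfRad_sub X t + 2 * X * hs
  obtain ⟨σ, hσ⟩ := X_pow_dvd_trunc_sub M s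
  obtain ⟨ω, hω⟩ := X_pow_dvd_trunc_sub M W
  have hC : (bivT : (Polynomial ℝ)⟦X⟧) = t :=
    Polynomial.coe_C _
  have hco : ∀ p : Polynomial (Polynomial ℝ),
      (p : (Polynomial ℝ)⟦X⟧) = Polynomial.coeToPowerSeries.ringHom p := fun _ => rfl
  have hcX : Polynomial.coeToPowerSeries.ringHom (Polynomial.X : Polynomial (Polynomial ℝ)) = X :=
    Polynomial.coe_X
  have hcC : Polynomial.coeToPowerSeries.ringHom
      bivT = t := hC
  have h1 : Polynomial.X ^ 1 ∣ trunc M s - 1 := by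
    refine X_pow_dvd_of_coe ?_
    rw [pow_one, PowerSeries.X_dvd_iff, Polynomial.coe_sub, Polynomial.coe_one, map_sub, map_one,
      ← coeff_zero_eq_constantCoeff_apply, Polynomial.coeff_coe, coeff_trunc,
      if_pos (Nat.pos_of_ne_zero hM), coeff_zero_eq_constantCoeff_apply, hs0, sub_self]
  obtain ⟨S', hS'⟩ := h1
  rw [pow_one] at hS'
  set S₀ : (Polynomial ℝ)⟦X⟧ := ((trunc M s : Polynomial (Polynomial ℝ)) : (Polynomial ℝ)⟦X⟧)
  obtain ⟨E', hE'⟩ : Polynomial.X ^ M ∣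
      trunc M s * trunc M s - egfRad Polynomial.X bivT := by
    refine X_pow_dvd_of_coe ⟨σ * (S₀ + s), ?_⟩
    have : ((egfRad Polynomial.X bivT : Polynomial (Polynomial ℝ)) :
        (Polynomial ℝ)⟦X⟧) = egfRad X t := by
      rw [hco]; simp only [egfRad, map_mul, map_add, map_sub, map_pow, map_ofNat, map_one, hcX, hcC]
    rw [Polynomial.coe_sub, Polynomial.coe_mul, this, ← hs]
    linear_combination (S₀ + s) * hσ
  obtain ⟨E, hE⟩ : Polynomial.X ^ M ∣ markedTrunc M * trunc M s * (trunc M s + (1 - Polynomial.X ^ 2))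
      - (numQuot Polynomial.X bivT * (trunc M s + (1 - Polynomial.X ^ 2))
        + 2 * Polynomial.X * radQuot Polynomial.X bivT) := by
    refine X_pow_dvd_of_coe ⟨ω * S₀
        * (S₀ + (1 - X ^ 2))
      + σ * (W * (S₀ + s + (1 - X ^ 2)) - numQuot X t), ?_⟩
    have e1 : ((numQuot Polynomial.X bivT : Polynomial (Polynomial ℝ)) :
        (Polynomial ℝ)⟦X⟧) = numQuot X t := by
      rw [hco]
      simp only [numQuot, map_mul, map_add, map_sub, map_pow, map_ofNat, hcX, hcC]
    have e2 : ((radQuot Polynomial.X bivT : Polynomial (Polynomial ℝ)) :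
        (Polynomial ℝ)⟦X⟧) = radQuot X t := by
      rw [hco]
      simp only [radQuot, map_mul, map_add, map_sub, map_pow, map_ofNat, map_neg, hcX, hcC]
    have e3 : ((2 : Polynomial (Polynomial ℝ)) : (Polynomial ℝ)⟦X⟧) = 2 := by
      rw [hco, map_ofNat]
    simp only [Polynomial.coe_sub, Polynomial.coe_mul, Polynomial.coe_add, Polynomial.coe_pow,
      Polynomial.coe_one, Polynomial.coe_X, e1, e2, e3, markedTrunc, ← hW]
    linear_combination (S₀
        * (S₀ + (1 - X ^ 2))) * hω
      + (W * (S₀ + s + (1 - X ^ 2)) - numQuot X t) * hσ + hreg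
  exact ⟨trunc M s, S', E, E', hS', hE', hE⟩

end Truncation

/-! ### Bounds for bivariate polynomials -/

section PolynomialBounds

/-- Evaluation of a polynomial in `x` with coefficients in `ℝ[t]`. -/
def evalAt (x t : ℝ) : Polynomial (Polynomial ℝ) →+* ℝ :=
  (Polynomial.evalRingHom t).comp (Polynomial.evalRingHom (Polynomial.C x))

theorem evalAt_X (x t : ℝ) : evalAt x t Polynomial.X = x := by simp [evalAt]

theorem evalAt_C (x t : ℝ) (p : Polynomial ℝ) : evalAt x t (Polynomial.C p) = p.eval t := by
  simp [evalAt]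

theorem exists_bound_polynomial (p : Polynomial ℝ) :
    ∃ C : ℝ, ∃ K : ℕ, 0 ≤ C ∧ ∀ t, 0 ≤ t → |p.eval t| ≤ C * (1 + t) ^ K := by
  refine ⟨∑ k ∈ Finset.range (p.natDegree + 1), |p.coeff k|, p.natDegree,
    Finset.sum_nonneg fun _ _ => abs_nonneg _, fun t ht => ?_⟩
  rw [Polynomial.eval_eq_sum_range, Finset.sum_mul]
  refine (Finset.abs_sum_le_sum_abs _ _).trans (Finset.sum_le_sum fun k hk => ?_)
  rw [abs_mul, abs_of_nonneg (pow_nonneg ht k)]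
  refine mul_le_mul_of_nonneg_left ?_ (abs_nonneg _)
  calc t ^ k ≤ (1 + t) ^ k := by gcongr; linarith
    _ ≤ (1 + t) ^ p.natDegree := pow_le_pow_right₀ (by linarith) (by simpa [Nat.lt_succ_iff] using hk)

/-- For `|x| ≤ 1` a bivariate polynomial grows at most like a power of `1 + t`. -/
theorem exists_bound_evalAt (p : Polynomial (Polynomial ℝ)) :
    ∃ C : ℝ, ∃ K : ℕ, 0 ≤ C ∧ ∀ x t, |x| ≤ 1 → 0 ≤ t → |evalAt x t p| ≤ C * (1 + t) ^ K := by
  induction p using Polynomial.induction_on' with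
  | add p q hp hq =>
    obtain ⟨C, K, hC, h⟩ := hp
    obtain ⟨C', K', hC', h'⟩ := hq
    refine ⟨C + C', K + K', by positivity, fun x t hx ht => ?_⟩
    rw [map_add]
    have h1 : (1 + t) ^ K ≤ (1 + t) ^ (K + K') := pow_le_pow_right₀ (by linarith) (by lia)
    have h2 : (1 + t) ^ K' ≤ (1 + t) ^ (K + K') := pow_le_pow_right₀ (by linarith) (by lia)
    calc |evalAt x t p + evalAt x t q| ≤ |evalAt x t p| + |evalAt x t q| := abs_add_le _ _
      _ ≤ C * (1 + t) ^ K + C' * (1 + t) ^ K' := add_le_add (h x t hx ht) (h' x t hx ht)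
      _ ≤ C * (1 + t) ^ (K + K') + C' * (1 + t) ^ (K + K') := by gcongr
      _ = _ := by ring
  | monomial n a =>
    obtain ⟨C, K, hC, h⟩ := exists_bound_polynomial a
    refine ⟨C, K, hC, fun x t hx ht => ?_⟩
    rw [← Polynomial.C_mul_X_pow_eq_monomial, map_mul, map_pow, evalAt_X, evalAt_C, abs_mul, abs_pow]
    calc |a.eval t| * |x| ^ n ≤ |a.eval t| * 1 := by gcongr; exact pow_le_one₀ (abs_nonneg x) hx
      _ ≤ _ := by rw [mul_one]; exact h t ht

/-- A common bound for finitely many polynomials. -/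
theorem exists_common_bound (s : Finset (Polynomial (Polynomial ℝ))) :
    ∃ C : ℝ, ∃ K : ℕ, 1 ≤ C ∧
      ∀ p ∈ s, ∀ x t, |x| ≤ 1 → 0 ≤ t → |evalAt x t p| ≤ C * (1 + t) ^ K := by
  classical
  induction s using Finset.induction_on with
  | empty => exact ⟨1, 0, le_rfl, by simp⟩
  | insert p s _ ih =>
    obtain ⟨C, K, hC, h⟩ := ih
    obtain ⟨C', K', hC', h'⟩ := exists_bound_evalAt p
    refine ⟨C + C', K + K', by linarith, fun q hq x t hx ht => ?_⟩
    have h1 : (1 + t) ^ K ≤ (1 + t) ^ (K + K') := pow_le_pow_right₀ (by linarith) (by lia)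
    have h2 : (1 + t) ^ K' ≤ (1 + t) ^ (K + K') := pow_le_pow_right₀ (by linarith) (by lia)
    have h3 : 0 ≤ (1 + t) ^ (K + K') := by positivity
    rw [add_mul]
    rcases Finset.mem_insert.1 hq with rfl | hq
    · have := (h' x t hx ht).trans (mul_le_mul_of_nonneg_left h2 hC')
      nlinarith
    · have := (h q hq x t hx ht).trans (mul_le_mul_of_nonneg_left h1 (by linarith))
      nlinarith

end PolynomialBounds

/-! ### The regular part of the integrand -/

section RegularIntegrand

/-- The principal square root of `egfRad x t`. -/
def radSqrt (x t : ℝ) : ℂ := ((egfRad x t : ℝ) : ℂ) ^ (1 / 2 : ℂ)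

/-- `egfIntegrand` without the factor `e⁻ᵗ` and without its pole at `t = x + 2`. With `s = √egfRad`,
`p = 1 - x²` and `δ = t - (x + 2)` the quotient `(δ numQuot - 2 x p) / (δ s)` is
`numQuot / s - 2 x p / (δ s)`, and `p / s = 1 - (s² - p²) / (s (s + p))` with `s² - p² = δ radQuot`. -/
def regIntegrand (x t : ℝ) : ℂ :=
  ((numQuot x t : ℝ) * (radSqrt x t + (1 - x ^ 2)) + 2 * x * (radQuot x t : ℝ))
    / (radSqrt x t * (radSqrt x t + (1 - x ^ 2)))

theorem radSqrt_mul_self (x t : ℝ) : radSqrt x t * radSqrt x t = ((egfRad x t : ℝ) : ℂ) := by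
  rw [radSqrt, ← pow_two, one_div]
  exact Complex.cpow_ofNat_inv_pow _ 2

theorem radSqrt_re_nonneg (x t : ℝ) : 0 ≤ (radSqrt x t).re := by
  rw [radSqrt, one_div, Complex.cpow_inv_two_re]
  exact Real.sqrt_nonneg _

theorem radSqrt_of_nonneg {x t : ℝ} (h : 0 ≤ egfRad x t) :
    radSqrt x t = (Real.sqrt (egfRad x t) : ℂ) := by
  rw [radSqrt, Real.sqrt_eq_rpow, Complex.ofReal_cpow h]
  norm_num

theorem norm_radSqrt (x t : ℝ) : ‖radSqrt x t‖ = Real.sqrt |egfRad x t| := by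
  rw [eq_comm, Real.sqrt_eq_iff_mul_self_eq (abs_nonneg _) (norm_nonneg _), ← norm_mul,
    radSqrt_mul_self, Complex.norm_real, Real.norm_eq_abs]

theorem half_le_norm_radSqrt_add {x : ℝ} (hx : |x| ≤ 1 / 10) (t : ℝ) :
    1 / 2 ≤ ‖radSqrt x t + (1 - (x : ℂ) ^ 2)‖ := by
  refine le_trans ?_ (Complex.re_le_norm _)
  have h1 := radSqrt_re_nonneg x t
  have h2 : x ^ 2 ≤ (1 / 10) ^ 2 := sq_le_sq' (by linarith [(abs_le.1 hx).1]) (abs_le.1 hx).2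
  have h3 : (radSqrt x t + (1 - (x : ℂ) ^ 2)).re = (radSqrt x t).re + (1 - x ^ 2) := by
    rw [← Complex.ofReal_pow, ← Complex.ofReal_one, ← Complex.ofReal_sub, Complex.add_re,
      Complex.ofReal_re]
  rw [h3]; linarith

/-- The inverse square root singularity of the integrand at a simple zero of the radicand. -/
def invSqrtAbs (y : ℝ) : ℝ := (Real.sqrt |y|)⁻¹

theorem invSqrtAbs_nonneg (y : ℝ) : 0 ≤ invSqrtAbs y := inv_nonneg.2 (Real.sqrt_nonneg _)

theorem inv_sqrt_le_of_le {x y z : ℝ} (hx : 0 < |x|) (hx1 : |x| ≤ 1)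
    (h : |x| * |y| / 4 ≤ z) (hy : y ≠ 0) : (Real.sqrt z)⁻¹ ≤ 2 * |x|⁻¹ * invSqrtAbs y := by
  have hy' : 0 < Real.sqrt |y| := Real.sqrt_pos.2 (abs_pos.2 hy)
  have h1 : |x| * Real.sqrt |y| / 2 ≤ Real.sqrt z := by
    refine Real.le_sqrt_of_sq_le (le_trans ?_ h)
    rw [div_pow, mul_pow, Real.sq_sqrt (abs_nonneg y)]
    nlinarith [abs_nonneg y, mul_nonneg (mul_nonneg hx.le (sub_nonneg.2 hx1)) (abs_nonneg y)]
  calc (Real.sqrt z)⁻¹ ≤ (|x| * Real.sqrt |y| / 2)⁻¹ := inv_anti₀ (by positivity) h1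
    _ = 2 * |x|⁻¹ * invSqrtAbs y := by
      unfold invSqrtAbs
      field_simp

/-- For small `x ≠ 0` one factor of the radicand is bounded below and the other one has two
separated simple zeros. -/
theorem exists_inv_norm_radSqrt_le {x : ℝ} (hx : |x| ≤ 1 / 10) (hx0 : x ≠ 0) :
    ∃ t₁ t₂ : ℝ, ∀ t, ‖radSqrt x t‖⁻¹ ≤ 2 * |x|⁻¹ * (invSqrtAbs (t - t₁) + invSqrtAbs (t - t₂)) := by
  obtain ⟨hl, hu⟩ := abs_le.1 hx
  set r := Real.sqrt ((1 - x) ^ 2 * ((x + 1) * (x + 5))) with hr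
  have hrad : 1 ≤ (1 - x) ^ 2 * ((x + 1) * (x + 5)) := by
    have h1 : (81 / 100 : ℝ) ≤ (1 - x) ^ 2 := by nlinarith
    have h2 : (4 : ℝ) ≤ (x + 1) * (x + 5) := by nlinarith
    nlinarith
  have hr2 : r ^ 2 = (1 - x) ^ 2 * ((x + 1) * (x + 5)) := Real.sq_sqrt (by linarith)
  have hr1 : 1 ≤ r := by rw [hr]; exact Real.one_le_sqrt.2 hrad
  have hxpos : 0 < |x| := abs_pos.2 hx0
  set t₁ := ((3 + 2 * x + x ^ 2) - r) / 2 / x with ht₁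
  set t₂ := ((3 + 2 * x + x ^ 2) + r) / 2 / x with ht₂
  have e1 : ∀ t, x * (t - t₁) = x * t - ((3 + 2 * x + x ^ 2) - r) / 2 := fun t => by
    rw [ht₁]; field_simp
  have e2 : ∀ t, x * (t - t₂) = x * t - ((3 + 2 * x + x ^ 2) + r) / 2 := fun t => by
    rw [ht₂]; field_simp
  refine ⟨t₁, t₂, fun t => ?_⟩
  -- the factors of `egfRad` are quadratic polynomials in `x t`
  have hfac : egfRad x t = (x * (t - t₁)) * (x * (t - t₂))
      * ((x * t) ^ 2 + (1 - 2 * x - x ^ 2) * (x * t) + 1) := by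
    rw [e1, e2]; unfold egfRad; linear_combination
      (1 / 4) * ((x * t) ^ 2 + (1 - 2 * x - x ^ 2) * (x * t) + 1) * hr2
  have hQ : 1 / 2 ≤ (x * t) ^ 2 + (1 - 2 * x - x ^ 2) * (x * t) + 1 := by
    have h1 : (1 - 2 * x - x ^ 2) ^ 2 ≤ 2 := by
      have h2 : 1 - 2 * x - x ^ 2 ≤ 6 / 5 := by nlinarith
      have h3 : 0 ≤ 1 - 2 * x - x ^ 2 := by nlinarith
      nlinarith
    nlinarith [sq_nonneg (x * t + (1 - 2 * x - x ^ 2) / 2)]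
  rw [norm_radSqrt]
  by_cases h1 : t = t₁
  · have : egfRad x t = 0 := by rw [hfac, h1]; ring
    rw [this]
    simp only [abs_zero, Real.sqrt_zero, inv_zero]
    have := invSqrtAbs_nonneg (t - t₁)
    have := invSqrtAbs_nonneg (t - t₂)
    positivity
  by_cases h2 : t = t₂
  · have : egfRad x t = 0 := by rw [hfac, h2]; ring
    rw [this]
    simp only [abs_zero, Real.sqrt_zero, inv_zero]
    have := invSqrtAbs_nonneg (t - t₁)
    have := invSqrtAbs_nonneg (t - t₂)
    positivity
  have habs : |egfRad x t| = (|x| * |t - t₁|) * (|x| * |t - t₂|)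
      * ((x * t) ^ 2 + (1 - 2 * x - x ^ 2) * (x * t) + 1) := by
    rw [hfac, abs_mul, abs_mul, abs_mul, abs_mul, abs_of_nonneg (by linarith : (0 : ℝ) ≤
      (x * t) ^ 2 + (1 - 2 * x - x ^ 2) * (x * t) + 1)]
  have hsep : 1 ≤ |x| * |t - t₁| + |x| * |t - t₂| := by
    rw [← abs_mul, ← abs_mul]
    have h3 : r = x * (t - t₁) - x * (t - t₂) := by rw [e1, e2]; ring
    calc 1 ≤ |r| := hr1.trans (le_abs_self r)
      _ ≤ _ := by rw [h3]; exact abs_sub _ _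
  have p1 : 0 ≤ |x| * |t - t₁| := by positivity
  have p2 : 0 ≤ |x| * |t - t₂| := by positivity
  have hx1 : |x| ≤ 1 := by linarith
  have n1 := invSqrtAbs_nonneg (t - t₁)
  have n2 := invSqrtAbs_nonneg (t - t₂)
  have hc : 0 ≤ 2 * |x|⁻¹ := by positivity
  rcases le_total (|x| * |t - t₁|) (|x| * |t - t₂|) with hle | hle
  · refine (inv_sqrt_le_of_le hxpos hx1 (y := t - t₁) ?_ (sub_ne_zero.2 h1)).trans ?_
    · rw [habs]
      have h4 : 1 / 2 ≤ |x| * |t - t₂| := by linarith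
      have h5 : |x| * |t - t₁| * (1 / 2) ≤ (|x| * |t - t₁|) * (|x| * |t - t₂|) := by gcongr
      nlinarith [mul_nonneg p1 p2]
    · nlinarith
  · refine (inv_sqrt_le_of_le hxpos hx1 (y := t - t₂) ?_ (sub_ne_zero.2 h2)).trans ?_
    · rw [habs]
      have h4 : 1 / 2 ≤ |x| * |t - t₁| := by linarith
      have h5 : (1 / 2) * (|x| * |t - t₂|) ≤ (|x| * |t - t₁|) * (|x| * |t - t₂|) := by gcongr
      nlinarith [mul_nonneg p1 p2]
    · nlinarith

end RegularIntegrand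

/-! ### The error of the truncated expansion -/

section PointwiseBound

theorem map_egfRad {A B : Type*} [CommRing A] [CommRing B] (f : A →+* B) (x t : A) :
    f (egfRad x t) = egfRad (f x) (f t) := by
  simp only [egfRad, map_mul, map_add, map_sub, map_pow, map_ofNat, map_one]

theorem map_numQuot {A B : Type*} [CommRing A] [CommRing B] (f : A →+* B) (x t : A) :
    f (numQuot x t) = numQuot (f x) (f t) := by
  simp only [numQuot, map_mul, map_add, map_sub, map_pow, map_ofNat]

theorem map_radQuot {A B : Type*} [CommRing A] [CommRing B] (f : A →+* B) (x t : A) :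
    f (radQuot x t) = radQuot (f x) (f t) := by
  simp only [radQuot, map_mul, map_add, map_sub, map_pow, map_ofNat, map_neg]

/-- Away from the zeros of the radicand, an approximate square root `σ` and an approximate
solution `v` of the algebraic equation determine the regular integrand up to their errors. -/
theorem abs_regular_sub_le {x D σ v n q p e e' B M : ℝ} (hB : 1 ≤ B) (hD : 1 / 2 ≤ D)
    (hσ : 1 / 2 ≤ σ) (hp0 : 0 ≤ p) (hp1 : p ≤ 1)
    (hσD : σ * σ - D = M * e')
    (hv : v * σ * (σ + p) - (n * (σ + p) + 2 * x * q) = M * e)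
    (hvB : |v| ≤ B) (hnB : |n| ≤ B) (heB : |e| ≤ B) (he'B : |e'| ≤ B) :
    |(n * (Real.sqrt D + p) + 2 * x * q) / (Real.sqrt D * (Real.sqrt D + p)) - v|
      ≤ 16 * B ^ 2 * |M| := by
  set s := Real.sqrt D with hs
  have hsD : s * s = D := Real.mul_self_sqrt (by linarith)
  have hs1 : 1 / 2 ≤ s := by
    rw [hs]; exact Real.le_sqrt_of_sq_le (by norm_num; linarith)
  have h1 : 0 < s := by linarith
  have h2 : 0 < s + p := by linarith
  have h3 : 0 < s + σ := by linarith
  have hdiff : s - σ = -(M * e') / (s + σ) := by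
    rw [eq_div_iff h3.ne']; linear_combination hsD - hσD
  have hmain : (n * (s + p) + 2 * x * q) / (s * (s + p)) - v
      = -M * (e + e' * n / (s + σ) - e' * v * (1 + p / (s + σ))) / (s * (s + p)) := by
    rw [div_sub' (by positivity)]
    congr 1
    have e1 : n * (s + p) + 2 * x * q - s * (s + p) * v
        = -(M * e) + (s - σ) * (n - v * (s + σ + p)) := by linear_combination -hv
    rw [e1, hdiff]
    field_simp
    ring
  have hinv : 1 / (s + σ) ≤ 1 := by rw [div_le_one h3]; linarith
  have hinv0 : 0 ≤ 1 / (s + σ) := by positivity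
  have b1 : |e' * n / (s + σ)| ≤ B * B := by
    rw [div_eq_mul_one_div, abs_mul, abs_mul, abs_of_nonneg hinv0]
    calc |e'| * |n| * (1 / (s + σ)) ≤ B * B * 1 := by gcongr
      _ = B * B := mul_one _
  have b2 : |e' * v * (1 + p / (s + σ))| ≤ B * B * 2 := by
    have h4 : p / (s + σ) ≤ 1 := by rw [div_le_one h3]; linarith
    have h5 : 0 ≤ p / (s + σ) := by positivity
    rw [abs_mul, abs_mul, abs_of_nonneg (by linarith : 0 ≤ 1 + p / (s + σ))]
    gcongr
    linarith
  have b3 : |e + e' * n / (s + σ) - e' * v * (1 + p / (s + σ))| ≤ 4 * B ^ 2 := by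
    have := abs_sub (e + e' * n / (s + σ)) (e' * v * (1 + p / (s + σ)))
    have := abs_add_le e (e' * n / (s + σ))
    nlinarith
  have hden : 1 / 4 ≤ s * (s + p) := by nlinarith
  rw [hmain, abs_div, abs_mul, abs_neg, abs_of_pos (mul_pos h1 h2), div_le_iff₀ (by positivity)]
  have hM := abs_nonneg M
  have hBM : 0 ≤ B ^ 2 * |M| := by positivity
  calc |M| * _ ≤ |M| * (4 * B ^ 2) := by gcongr
    _ ≤ 16 * B ^ 2 * |M| * (s * (s + p)) := by nlinarith

theorem norm_regIntegrand_le {x t B : ℝ} (hx : |x| ≤ 1 / 10) (hB : 0 ≤ B)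
    (hn : |numQuot x t| ≤ B) (hq : |radQuot x t| ≤ B) :
    ‖regIntegrand x t‖ ≤ 2 * B * ‖radSqrt x t‖⁻¹ := by
  have h1 := half_le_norm_radSqrt_add hx t
  rw [regIntegrand, norm_div, norm_mul, div_eq_mul_inv, mul_inv]
  set w : ℂ := radSqrt x t + (1 - (x : ℂ) ^ 2)
  have hw : 0 < ‖w‖ := by linarith
  have h2 : ‖((numQuot x t : ℝ) : ℂ) * w + 2 * x * ((radQuot x t : ℝ) : ℂ)‖ ≤ 2 * B * ‖w‖ := by
    refine (norm_add_le _ _).trans ?_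
    rw [norm_mul, norm_mul, norm_mul, Complex.norm_real, Complex.norm_real, Complex.norm_real,
      Real.norm_eq_abs, Real.norm_eq_abs, Real.norm_eq_abs, Complex.norm_ofNat]
    have h3 : 2 * |x| * |radQuot x t| ≤ 2 * (1 / 10) * B := by gcongr
    have h4 : |numQuot x t| * ‖w‖ ≤ B * ‖w‖ := by gcongr
    nlinarith
  calc _ ≤ (2 * B * ‖w‖) * (‖radSqrt x t‖⁻¹ * ‖w‖⁻¹) := by gcongr
    _ = _ := by field_simp

/-- For small `x` the regular integrand differs from its truncated expansion by `O(x^M)`, up to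
polynomial growth and two integrable singularities. Where `x` is small relative to a power of
`1 + t` the radicand is close to `1`; elsewhere a power of `1 + t` exceeds any power of `1 / x`. -/
theorem exists_pointwise_bound {M : ℕ} (hM : M ≠ 0) :
    ∃ C : ℝ, ∃ K : ℕ, 0 ≤ C ∧ ∀ x, |x| ≤ 1 / 10 → ∃ t₁ t₂ : ℝ, ∀ t, 0 ≤ t →
      ‖regIntegrand x t - (evalAt x t (markedTrunc M) : ℝ)‖
        ≤ C * |x| ^ M * (1 + t) ^ K * (1 + (invSqrtAbs (t - t₁) + invSqrtAbs (t - t₂))) := by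
  classical
  obtain ⟨S, S', E, E', hS, hE', hE⟩ := exists_truncated_equations hM
  obtain ⟨R', hR'⟩ : Polynomial.X ∣ egfRad Polynomial.X bivT - 1 := by
    rw [Polynomial.X_dvd_iff, Polynomial.coeff_zero_eq_eval_zero, Polynomial.eval_sub,
      ← Polynomial.coe_evalRingHom, map_egfRad]
    simp [egfRad]
  obtain ⟨C, K, hC, hbound⟩ := exists_common_bound
    {numQuot Polynomial.X bivT, radQuot Polynomial.X bivT, S', E, E', R', markedTrunc M}
  simp only [Finset.mem_insert, Finset.mem_singleton, forall_eq_or_imp, forall_eq] at hbound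
  obtain ⟨bn, bq, bS, bE, bE', bR, bV⟩ := hbound
  refine ⟨16 * 2 ^ (M + 1) * C ^ (M + 2), K * (M + 2), by positivity, fun x hx => ?_⟩
  have hx1 : |x| ≤ 1 := by linarith
  obtain ⟨t₁, t₂, ht⟩ : ∃ t₁ t₂ : ℝ, x ≠ 0 → ∀ t,
      ‖radSqrt x t‖⁻¹ ≤ 2 * |x|⁻¹ * (invSqrtAbs (t - t₁) + invSqrtAbs (t - t₂)) := by
    by_cases hx0 : x = 0
    · exact ⟨0, 0, fun h => absurd hx0 h⟩
    · obtain ⟨t₁, t₂, h⟩ := exists_inv_norm_radSqrt_le hx hx0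
      exact ⟨t₁, t₂, fun _ => h⟩
  refine ⟨t₁, t₂, fun t ht0 => ?_⟩
  have ev : ∀ {p q : Polynomial (Polynomial ℝ)}, p = q → evalAt x t p = evalAt x t q :=
    fun h => by rw [h]
  have hT : evalAt x t bivT = t := by rw [evalAt_C, Polynomial.eval_X]
  replace bn := bn x t hx1 ht0
  replace bq := bq x t hx1 ht0
  replace bS := bS x t hx1 ht0
  replace bE := bE x t hx1 ht0
  replace bE' := bE' x t hx1 ht0
  replace bR := bR x t hx1 ht0
  replace bV := bV x t hx1 ht0
  rw [map_numQuot, evalAt_X, hT] at bn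
  rw [map_radQuot, evalAt_X, hT] at bq
  replace hS := ev hS
  replace hE' := ev hE'
  replace hE := ev hE
  replace hR' := ev hR'
  simp only [map_sub, map_mul, map_add, map_pow, map_one, map_ofNat, map_egfRad, map_numQuot,
    map_radQuot, evalAt_X, hT] at hS hE' hE hR'
  set V := evalAt x t (markedTrunc M)
  set B := C * (1 + t) ^ K with hB
  have h1t : 1 ≤ (1 + t) ^ K := one_le_pow₀ (by linarith)
  have hB1 : 1 ≤ B := by nlinarith
  set H := invSqrtAbs (t - t₁) + invSqrtAbs (t - t₂) with hH
  have hH0 : 0 ≤ H := add_nonneg (invSqrtAbs_nonneg _) (invSqrtAbs_nonneg _)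
  have hpow : 16 * 2 ^ (M + 1) * C ^ (M + 2) * |x| ^ M * (1 + t) ^ (K * (M + 2)) * (1 + H)
      = 16 * 2 ^ (M + 1) * B ^ (M + 2) * |x| ^ M * (1 + H) := by
    rw [hB, mul_pow, ← pow_mul]; ring
  rw [hpow]
  by_cases hreg : |x| * B ≤ 1 / 2
  · -- the region where `egfRad x t` and the truncated square root are close to `1`
    have hD : 1 / 2 ≤ egfRad x t := by
      have : |egfRad x t - 1| ≤ 1 / 2 := by
        rw [hR', abs_mul]
        exact (mul_le_mul_of_nonneg_left bR (abs_nonneg x)).trans hreg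
      linarith [(abs_le.1 this).1]
    have hσ : 1 / 2 ≤ evalAt x t S := by
      have : |evalAt x t S - 1| ≤ 1 / 2 := by
        rw [hS, abs_mul]
        exact (mul_le_mul_of_nonneg_left bS (abs_nonneg x)).trans hreg
      linarith [(abs_le.1 this).1]
    have hx2 : x ^ 2 ≤ 1 := by rw [← sq_abs]; exact pow_le_one₀ (abs_nonneg x) hx1
    have key := abs_regular_sub_le (p := 1 - x ^ 2) hB1 hD hσ (by linarith)
      (by linarith [sq_nonneg x]) hE' hE bV bn bE bE'
    have hcast : regIntegrand x t - (V : ℝ) = (((numQuot x t * (Real.sqrt (egfRad x t) + (1 - x ^ 2))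
        + 2 * x * radQuot x t) / (Real.sqrt (egfRad x t) * (Real.sqrt (egfRad x t) + (1 - x ^ 2)))
        - V : ℝ) : ℂ) := by
      rw [regIntegrand, radSqrt_of_nonneg (by linarith)]
      push_cast
      rfl
    rw [hcast, Complex.norm_real, Real.norm_eq_abs]
    refine key.trans ?_
    rw [abs_pow]
    have h2 : (1 : ℝ) ≤ 2 ^ (M + 1) := one_le_pow₀ (by norm_num)
    have h3 : B ^ 2 ≤ B ^ (M + 2) := pow_le_pow_right₀ hB1 (by lia)
    calc 16 * B ^ 2 * |x| ^ M = 16 * 1 * B ^ 2 * |x| ^ M * 1 := by ring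
      _ ≤ _ := by gcongr; linarith
  · -- the region where `1 ≤ 2 |x| B`, so that powers of `x` may be inserted
    have hx0 : x ≠ 0 := by
      rintro rfl
      apply hreg
      simp
    have hxpos : 0 < |x| := abs_pos.2 hx0
    have hbig : 1 ≤ 2 * |x| * B := by linarith [not_le.1 hreg]
    have h2 : ‖regIntegrand x t‖ ≤ 4 * B * |x|⁻¹ * H := by
      refine (norm_regIntegrand_le hx (by linarith) bn bq).trans ?_
      calc 2 * B * ‖radSqrt x t‖⁻¹ ≤ 2 * B * (2 * |x|⁻¹ * H) := by
            gcongr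
            exact ht hx0 t
        _ = _ := by ring
    have hinv : 1 ≤ |x|⁻¹ := (one_le_inv₀ hxpos).2 hx1
    have h3 : ‖regIntegrand x t - (V : ℝ)‖ ≤ 4 * B * |x|⁻¹ * (1 + H) := by
      refine (norm_sub_le _ _).trans ?_
      rw [Complex.norm_real, Real.norm_eq_abs]
      have h4 : B ≤ 4 * B * |x|⁻¹ := by nlinarith
      linarith
    refine h3.trans ?_
    have h5 : 1 ≤ (2 * |x| * B) ^ (M + 1) := one_le_pow₀ hbig
    calc 4 * B * |x|⁻¹ * (1 + H) = 4 * B * |x|⁻¹ * 1 * (1 + H) := by ring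
      _ ≤ 16 * B * |x|⁻¹ * (2 * |x| * B) ^ (M + 1) * (1 + H) := by gcongr; norm_num
      _ = 16 * 2 ^ (M + 1) * B ^ (M + 2) * |x| ^ M * (1 + H) := by
        rw [mul_pow, mul_pow]
        field_simp
        ring

end PointwiseBound

/-! ### Integration of the error -/

section Asymptotics

/-- The function `|y|^(-1/2)` cut off at `|y| = 1`. Its integral over a half-line is bounded
independently of where the singularity lies. -/
def singWeight (y : ℝ) : ℝ :=
  (Ioc 0 1).indicator (fun y : ℝ => y ^ (-(1 / 2) : ℝ)) y
    + (Ioc 0 1).indicator (fun y : ℝ => y ^ (-(1 / 2) : ℝ)) (-y)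

theorem integrable_singWeight : Integrable singWeight := by
  have h : Integrable ((Ioc 0 1).indicator fun y : ℝ => y ^ (-(1 / 2) : ℝ)) := by
    rw [integrable_indicator_iff measurableSet_Ioc,
      ← intervalIntegrable_iff_integrableOn_Ioc_of_le zero_le_one]
    exact intervalIntegral.intervalIntegrable_rpow' (by norm_num)
  exact h.add h.comp_neg

theorem singWeight_nonneg (y : ℝ) : 0 ≤ singWeight y := by
  have h : ∀ y, 0 ≤ (Ioc 0 1).indicator (fun y : ℝ => y ^ (-(1 / 2) : ℝ)) y := fun y =>
    indicator_nonneg (fun y hy => Real.rpow_nonneg hy.1.le _) y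
  exact add_nonneg (h y) (h (-y))

theorem invSqrtAbs_le (y : ℝ) : invSqrtAbs y ≤ 1 + singWeight y := by
  have hpos : ∀ y, 0 < y → y ≤ 1 → invSqrtAbs y
      = (Ioc 0 1).indicator (fun y : ℝ => y ^ (-(1 / 2) : ℝ)) y := fun y h0 h1 => by
    rw [indicator_of_mem (show y ∈ Ioc 0 1 from ⟨h0, h1⟩), invSqrtAbs, abs_of_pos h0,
      Real.rpow_neg h0.le, Real.sqrt_eq_rpow]
  have h : ∀ y, 0 ≤ (Ioc 0 1).indicator (fun y : ℝ => y ^ (-(1 / 2) : ℝ)) y := fun y =>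
    indicator_nonneg (fun y hy => Real.rpow_nonneg hy.1.le _) y
  rcases eq_or_ne y 0 with rfl | h0
  · have := singWeight_nonneg 0
    simp only [invSqrtAbs, abs_zero, Real.sqrt_zero, inv_zero]
    linarith
  rcases le_or_gt |y| 1 with h1 | h1
  · rcases lt_or_gt_of_ne h0 with hneg | hp
    · have e : invSqrtAbs y = invSqrtAbs (-y) := by rw [invSqrtAbs, invSqrtAbs, abs_neg]
      rw [e, hpos (-y) (by linarith) (by linarith [(abs_le.1 h1).1]), singWeight]
      linarith [h y]
    · rw [hpos y hp (abs_le.1 h1).2, singWeight]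
      linarith [h (-y)]
  · have : invSqrtAbs y ≤ 1 := inv_le_one_of_one_le₀ (Real.one_le_sqrt.2 h1.le)
    linarith [singWeight_nonneg y]

theorem one_add_pow_mul_exp_neg_le (K : ℕ) {t : ℝ} (ht : 0 ≤ t) :
    (1 + t) ^ K * Real.exp (-t) ≤ K.factorial * Real.exp 1 := by
  have h := Real.pow_div_factorial_le_exp (1 + t) (by linarith) K
  rw [div_le_iff₀ (by positivity)] at h
  calc (1 + t) ^ K * Real.exp (-t) ≤ (Real.exp (1 + t) * K.factorial) * Real.exp (-t) := by gcongr
    _ = K.factorial * (Real.exp (1 + t) * Real.exp (-t)) := by ring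
    _ = _ := by rw [← Real.exp_add]; congr 2; ring

theorem measurable_regIntegrand (x : ℝ) : Measurable (regIntegrand x) := by
  have h1 : Measurable (radSqrt x) := by
    unfold radSqrt
    refine Measurable.pow_const (Complex.measurable_ofReal.comp ?_) _
    unfold egfRad
    fun_prop
  have h2 : Measurable (numQuot x) := by
    unfold numQuot
    fun_prop
  have h3 : Measurable (radQuot x) := by
    unfold radQuot
    fun_prop
  unfold regIntegrand
  fun_prop

theorem evalAt_markedTrunc (M : ℕ) (x t : ℝ) : evalAt x t (markedTrunc M)
    = ∑ n ∈ Finset.range M, (egfSeries t).coeff (n : ℤ) * x ^ n := by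
  have h3 : (3 : (Polynomial ℝ)⟦X⟧) = PowerSeries.C 3 := (map_ofNat PowerSeries.C 3).symm
  rw [markedTrunc, trunc_apply, map_sum, ← Nat.Ico_zero_eq_range]
  refine Finset.sum_congr rfl fun n _ => ?_
  rw [← Polynomial.C_mul_X_pow_eq_monomial, map_mul, map_pow, evalAt_X, evalAt_C, coeff_egfSeries,
    map_sub, Polynomial.eval_sub, markedSeries, coeff_mk, eval_markedCount, h3, PowerSeries.coeff_C]
  split_ifs <;> simp

theorem integrableOn_markedTrunc (M : ℕ) (x : ℝ) :
    IntegrableOn (fun t => evalAt x t (markedTrunc M) * Real.exp (-t)) (Ioi 0) := by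
  simp only [evalAt_markedTrunc, Finset.sum_mul]
  refine integrable_finsetSum _ fun n _ => ?_
  have := ((egf_integral_formula n).1.mul_const (x ^ n))
  refine this.congr (Eventually.of_forall fun t => ?_)
  simp only
  ring

/-- Integrated against `e⁻ᵗ`, the truncated expansion is a partial sum of the generating function, up
to the polynomial `-2 + 2 x`. Its degree is why at least two terms are taken. -/
theorem integral_markedTrunc (m : ℕ) (x : ℝ) :
    ∫ t in Ioi (0 : ℝ), evalAt x t (markedTrunc (m + 2)) * Real.exp (-t)
      = ∑ n ∈ Finset.range (m + 2), PowerSeries.coeff n egf * x ^ n - (-2 + 2 * x) := by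
  have h1 : ∀ t : ℝ, evalAt x t (markedTrunc (m + 2)) * Real.exp (-t)
      = ∑ n ∈ Finset.range (m + 2),
        x ^ n * ((egfSeries t).coeff (n : ℤ) * Real.exp (-t)) := fun t => by
    rw [evalAt_markedTrunc, Finset.sum_mul]
    exact Finset.sum_congr rfl fun n _ => by ring
  have h2 : ∑ n ∈ Finset.range (m + 2),
      PowerSeries.coeff n (-2 + 2 * PowerSeries.X : PowerSeries ℝ) * x ^ n = -2 + 2 * x := by
    have hC : (2 : ℝ⟦X⟧) = PowerSeries.C 2 := (map_ofNat PowerSeries.C 2).symm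
    rw [Finset.sum_range_succ', Finset.sum_range_succ']
    simp only [hC, map_add, ← map_neg, PowerSeries.coeff_C, PowerSeries.coeff_C_mul,
      PowerSeries.coeff_X]
    simp
    ring
  simp only [h1]
  rw [integral_finsetSum _ fun n _ => (egf_integral_formula n).1.const_mul _, ← h2,
    ← Finset.sum_sub_distrib]
  refine Finset.sum_congr rfl fun n _ => ?_
  rw [integral_const_mul, (egf_integral_formula n).2]
  ring

/-- The integral of the regular part differs from that of its truncated expansion by `O(x^M)`. The
constant is uniform in `x`: the singularities move with `x`, but the weight `(1 + t)^K e⁻ᵗ` is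
bounded and the integral of `singWeight` is invariant under translation. -/
theorem exists_integral_bound {M : ℕ} (hM : M ≠ 0) :
    ∃ C : ℝ, ∀ x, |x| ≤ 1 / 10 →
      IntegrableOn (fun t => (regIntegrand x t - (evalAt x t (markedTrunc M) : ℝ))
        * Real.exp (-t)) (Ioi 0) ∧
      ‖∫ t in Ioi (0 : ℝ), (regIntegrand x t - (evalAt x t (markedTrunc M) : ℝ)) * Real.exp (-t)‖
        ≤ C * |x| ^ M := by
  obtain ⟨C, K, hC, hb⟩ := exists_pointwise_bound hM
  set A : ℝ := K.factorial * Real.exp 1 with hA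
  have hA0 : 0 ≤ A := by positivity
  have hpoly : IntegrableOn (fun t : ℝ => (1 + t) ^ K * Real.exp (-t)) (Ioi 0) := by
    have := integrableOn_polynomial_mul_exp_neg ((1 + Polynomial.X) ^ K)
    simpa using this
  set I := ∫ t in Ioi (0 : ℝ), (1 + t) ^ K * Real.exp (-t) with hI
  set J := ∫ y, singWeight y with hJ
  refine ⟨C * (3 * I + A * (2 * J)), fun x hx => ?_⟩
  obtain ⟨t₁, t₂, h⟩ := hb x hx
  have hw : ∀ s, Integrable fun t => singWeight (t - s) := fun s =>
    integrable_singWeight.comp_sub_right s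
  let G : ℝ → ℝ := fun t => C * |x| ^ M * (3 * ((1 + t) ^ K * Real.exp (-t))
    + A * (singWeight (t - t₁) + singWeight (t - t₂)))
  have hG : IntegrableOn G (Ioi 0) :=
    ((hpoly.const_mul 3).add ((((hw t₁).add (hw t₂)).const_mul A).integrableOn)).const_mul _
  have hle : ∀ t, 0 ≤ t →
      ‖(regIntegrand x t - (evalAt x t (markedTrunc M) : ℝ)) * Real.exp (-t)‖ ≤ G t := by
    intro t ht
    rw [norm_mul, Complex.norm_real, Real.norm_eq_abs, abs_of_pos (Real.exp_pos _)]
    have h1 := invSqrtAbs_le (t - t₁)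
    have h2 := invSqrtAbs_le (t - t₂)
    have w1 := singWeight_nonneg (t - t₁)
    have w2 := singWeight_nonneg (t - t₂)
    have h3 := one_add_pow_mul_exp_neg_le K ht
    rw [← hA] at h3
    have hcx : 0 ≤ C * |x| ^ M := by positivity
    calc _ ≤ (C * |x| ^ M * (1 + t) ^ K
          * (1 + (invSqrtAbs (t - t₁) + invSqrtAbs (t - t₂)))) * Real.exp (-t) := by
          gcongr
          exact h t ht
      _ = C * |x| ^ M * (((1 + t) ^ K * Real.exp (-t))
          * (1 + (invSqrtAbs (t - t₁) + invSqrtAbs (t - t₂)))) := by ring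
      _ ≤ C * |x| ^ M * (((1 + t) ^ K * Real.exp (-t))
          * (3 + (singWeight (t - t₁) + singWeight (t - t₂)))) := by
          refine mul_le_mul_of_nonneg_left (mul_le_mul_of_nonneg_left ?_ (by positivity)) hcx
          linarith
      _ = C * |x| ^ M * (3 * ((1 + t) ^ K * Real.exp (-t)) + ((1 + t) ^ K * Real.exp (-t))
          * (singWeight (t - t₁) + singWeight (t - t₂))) := by ring
      _ ≤ G t := by
          simp only [G]
          gcongr
  have hae : ∀ᵐ t ∂(volume.restrict (Ioi (0 : ℝ))),
      ‖(regIntegrand x t - (evalAt x t (markedTrunc M) : ℝ)) * Real.exp (-t)‖ ≤ G t := by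
    filter_upwards [ae_restrict_mem measurableSet_Ioi] with t ht
    exact hle t (le_of_lt ht)
  have hmeas : Measurable fun t =>
      (regIntegrand x t - (evalAt x t (markedTrunc M) : ℝ)) * Real.exp (-t) := by
    have h1 : Measurable fun t => evalAt x t (markedTrunc M) :=
      ((markedTrunc M).eval (Polynomial.C x)).continuous.measurable
    have h2 := measurable_regIntegrand x
    fun_prop
  refine ⟨Integrable.mono' hG hmeas.aestronglyMeasurable hae, ?_⟩
  refine (norm_integral_le_of_norm_le hG hae).trans ?_
  have hws : ∀ s, ∫ t in Ioi (0 : ℝ), singWeight (t - s) ≤ J := fun s => by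
    rw [hJ, ← integral_sub_right_eq_self singWeight s]
    exact setIntegral_le_integral (hw s) (Eventually.of_forall fun t => singWeight_nonneg _)
  have hGint : ∫ t in Ioi (0 : ℝ), G t = C * |x| ^ M * (3 * I
      + A * ((∫ t in Ioi (0 : ℝ), singWeight (t - t₁)) + ∫ t in Ioi (0 : ℝ), singWeight (t - t₂))) := by
    have hsum : IntegrableOn (fun t => A * (singWeight (t - t₁) + singWeight (t - t₂))) (Ioi 0) :=
      (((hw t₁).add (hw t₂)).const_mul A).integrableOn
    simp only [G]
    rw [integral_const_mul, integral_add (hpoly.const_mul 3) hsum, integral_const_mul,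
      integral_const_mul, integral_add (hw t₁).integrableOn (hw t₂).integrableOn]
  rw [hGint]
  have hcx : 0 ≤ C * |x| ^ M := by positivity
  calc _ ≤ C * |x| ^ M * (3 * I + A * (J + J)) := by
        gcongr
        · exact hws t₁
        · exact hws t₂
    _ = _ := by ring

end Asymptotics

/-! ### The closed form and its asymptotic expansion -/

section ClosedForm

/-- The zeros of the radicand, where the complex power and the quotients have junk values, form a
null set. -/
theorem ae_egfRad_ne_zero {x : ℝ} (hx : |x| ≤ 1 / 10) : ∀ᵐ t : ℝ, egfRad x t ≠ 0 := by
  set p : Polynomial ℝ := egfRad (Polynomial.C x) Polynomial.X with hp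
  have hev : ∀ t, p.eval t = egfRad x t := fun t => by
    rw [hp, ← Polynomial.coe_evalRingHom, map_egfRad]
    simp
  have hne : p ≠ 0 := by
    intro h0
    have h1 := hev (x + 2)
    have h2 := egfRad_sub x (x + 2)
    rw [h0, Polynomial.eval_zero] at h1
    rw [← h1, sub_self, zero_mul] at h2
    have h3 : x ^ 2 ≤ (1 / 10) ^ 2 := sq_le_sq' (by linarith [(abs_le.1 hx).1]) (abs_le.1 hx).2
    nlinarith
  rw [ae_iff]
  refine Set.Finite.measure_zero ((Polynomial.finite_setOfPred_isRoot hne).subset fun t ht => ?_) _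
  simp only [not_not, Set.mem_ofPred_eq] at ht
  rw [Set.mem_ofPred_eq, Polynomial.IsRoot, hev, ht]

/-- The pole of `egfIntegrand` splits off as a multiple of the integrand of the exponential
integral. -/
theorem egfIntegrand_eq {x t : ℝ} (hx : |x| ≤ 1 / 10) (hD : egfRad x t ≠ 0) (ht : t ≠ x + 2) :
    egfIntegrand x t = regIntegrand x t * Real.exp (-t)
      + ((2 * x) • Complex.ofRealCLM) (Real.exp (-t) / (x + 2 - t)) := by
  have hnum : egfNum (x : ℂ) (t : ℂ) = ((t : ℂ) - (x + 2)) * ((numQuot x t : ℝ) : ℂ)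
      - 2 * x * (1 - (x : ℂ) ^ 2) := by
    rw [show ((numQuot x t : ℝ) : ℂ) = numQuot (x : ℂ) t from map_numQuot Complex.ofRealHom x t]
    linear_combination egfNum_add (x : ℂ) t
  have hrad : (egfRad (x : ℂ) (t : ℂ)) ^ (1 / 2 : ℂ) = radSqrt x t := by
    rw [radSqrt]; congr 1; exact (map_egfRad Complex.ofRealHom x t).symm
  have hsq : radSqrt x t * radSqrt x t - (1 - (x : ℂ) ^ 2) ^ 2
      = ((t : ℂ) - (x + 2)) * ((radQuot x t : ℝ) : ℂ) := by
    rw [radSqrt_mul_self, show ((egfRad x t : ℝ) : ℂ) = egfRad (x : ℂ) t from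
      map_egfRad Complex.ofRealHom x t, show ((radQuot x t : ℝ) : ℂ) = radQuot (x : ℂ) t from
      map_radQuot Complex.ofRealHom x t, egfRad_sub]
  have hs : radSqrt x t ≠ 0 := by
    intro h0
    have := radSqrt_mul_self x t
    rw [h0, mul_zero] at this
    exact hD (by exact_mod_cast this.symm)
  have hw : radSqrt x t + (1 - (x : ℂ) ^ 2) ≠ 0 := by
    have := half_le_norm_radSqrt_add hx t
    intro h0
    rw [h0, norm_zero] at this
    linarith
  have hδ : (t : ℂ) - (x + 2) ≠ 0 := by
    intro h0
    exact ht (by exact_mod_cast sub_eq_zero.1 h0)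
  have hδ' : (x : ℂ) + 2 - t ≠ 0 := by
    intro h0
    exact hδ (by linear_combination -h0)
  rw [egfIntegrand, hrad, hnum, regIntegrand]
  simp only [FunLike.coe_smul, Pi.smul_apply, Complex.ofRealCLM_apply,
    Complex.real_smul]
  push_cast
  set s := radSqrt x t
  set q := ((radQuot x t : ℝ) : ℂ)
  set n := ((numQuot x t : ℝ) : ℂ)
  set e := Complex.exp (-(t : ℂ))
  have h1 : (2 : ℂ) * x * (e / (x + 2 - t)) = -(2 * x * e) / (t - (x + 2)) := by
    rw [← neg_sub, div_neg]; ring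
  rw [h1, div_mul_eq_mul_div, div_add_div _ _ (mul_ne_zero hs hw) hδ,
    div_eq_div_iff (mul_ne_zero hδ hs) (mul_ne_zero (mul_ne_zero hs hw) hδ)]
  linear_combination (2 * x * e * s * ((t : ℂ) - (x + 2))) * hsq

theorem integrableOn_regIntegrand {x : ℝ} (hx : |x| ≤ 1 / 10) :
    IntegrableOn (fun t => regIntegrand x t * Real.exp (-t)) (Ioi 0) := by
  obtain ⟨C, h⟩ := exists_integral_bound (M := 1) one_ne_zero
  have h2 : IntegrableOn (fun t => (((evalAt x t (markedTrunc 1) * Real.exp (-t) : ℝ)) : ℂ))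
      (Ioi 0) := (integrableOn_markedTrunc 1 x).ofReal
  refine ((h x hx).1.add h2).congr (Eventually.of_forall fun t => ?_)
  simp only [Pi.add_apply]
  push_cast
  ring

theorem hasPV_egfIntegrand {x : ℝ} (hx : |x| ≤ 1 / 10) :
    HasPV (Ioi 0) (egfIntegrand x) (x + 2)
      ((∫ t in Ioi (0 : ℝ), regIntegrand x t * Real.exp (-t))
        + ((2 * x) • Complex.ofRealCLM) (Real.exp (-x - 2) * Ei (x + 2))) := by
  have h1 := HasPV.of_integrableOn measurableSet_Ioi (integrableOn_regIntegrand hx) (x + 2)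
  have h2 := (hasPV_exp_neg_div_sub (x := x) (by linarith [(abs_le.1 hx).1])).clm_comp
    ((2 * x) • Complex.ofRealCLM)
  refine (h1.add h2).congr_ae measurableSet_Ioi ?_
  have hne : ∀ᵐ t : ℝ, t ≠ x + 2 := by simp [ae_iff]
  filter_upwards [ae_egfRad_ne_zero hx, hne] with t h3 h4 _
  exact (egfIntegrand_eq hx h3 h4).symm

/-- The exponential integral in the closed form cancels the contribution of the pole. -/
theorem egfClosedForm_eq {x : ℝ} (hx : |x| ≤ 1 / 10) :
    egfClosedForm x = ((-2 + 2 * x : ℝ) : ℂ)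
      + ∫ t in Ioi (0 : ℝ), regIntegrand x t * Real.exp (-t) := by
  rw [egfClosedForm, (hasPV_egfIntegrand hx).pv_eq]
  simp only [FunLike.coe_smul, Pi.smul_apply, Complex.ofRealCLM_apply,
    Complex.real_smul]
  push_cast
  ring

theorem eventually_abs_le : ∀ᶠ x : ℝ in 𝓝 0, |x| ≤ 1 / 10 := by
  filter_upwards [Metric.ball_mem_nhds (0 : ℝ) (show (0 : ℝ) < 1 / 10 by norm_num)] with x hx
  rw [Metric.mem_ball, dist_zero_right, Real.norm_eq_abs] at hx
  exact hx.le

theorem hasPV_eventually :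
    ∀ᶠ x : ℝ in 𝓝 0,
      HasPV (Ioi 0) (fun t : ℝ => Real.exp (-t) / (x + 2 - t)) (x + 2)
        (Real.exp (-x - 2) * Ei (x + 2)) ∧
      HasPV (Ioi 0) (egfIntegrand x) (x + 2) (pv (Ioi 0) (egfIntegrand x) (x + 2)) := by
  filter_upwards [eventually_abs_le] with x hx
  refine ⟨hasPV_exp_neg_div_sub (by linarith [(abs_le.1 hx).1]), ?_⟩
  have := hasPV_egfIntegrand hx
  rwa [this.pv_eq]

theorem egfClosedForm_sub_isBigO_add_two (m : ℕ) :
    (fun x : ℝ => egfClosedForm x - ∑ n ∈ Finset.range (m + 2),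
      ((PowerSeries.coeff n egf * x ^ n : ℝ) : ℂ)) =O[𝓝 0] fun x : ℝ => x ^ (m + 2) := by
  obtain ⟨C, h⟩ := exists_integral_bound (M := m + 2) (by lia)
  refine IsBigO.of_bound C ?_
  filter_upwards [eventually_abs_le] with x hx
  obtain ⟨h1, h2⟩ := h x hx
  have h3 : IntegrableOn (fun t => (((evalAt x t (markedTrunc (m + 2)) * Real.exp (-t) : ℝ)) : ℂ))
      (Ioi 0) := (integrableOn_markedTrunc (m + 2) x).ofReal
  have h4 : egfClosedForm x - ∑ n ∈ Finset.range (m + 2),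
      ((PowerSeries.coeff n egf * x ^ n : ℝ) : ℂ) = ∫ t in Ioi (0 : ℝ),
        (regIntegrand x t - (evalAt x t (markedTrunc (m + 2)) : ℝ)) * Real.exp (-t) := by
    have e1 : ∀ t : ℝ, (regIntegrand x t - (evalAt x t (markedTrunc (m + 2)) : ℝ)) * Real.exp (-t)
        = regIntegrand x t * Real.exp (-t)
          - ((evalAt x t (markedTrunc (m + 2)) * Real.exp (-t) : ℝ) : ℂ) := fun t => by
      push_cast; ring
    simp only [e1]
    have e2 : ∫ t in Ioi (0 : ℝ), ((evalAt x t (markedTrunc (m + 2)) * Real.exp (-t) : ℝ) : ℂ)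
        = ((∫ t in Ioi (0 : ℝ), evalAt x t (markedTrunc (m + 2)) * Real.exp (-t) : ℝ) : ℂ) :=
      integral_ofReal
    rw [integral_sub (integrableOn_regIntegrand hx) h3, e2, integral_markedTrunc,
      egfClosedForm_eq hx]
    push_cast
    ring
  rw [h4, norm_pow, Real.norm_eq_abs]
  exact h2

theorem egfClosedForm_sub_isBigO (N : ℕ) :
    (fun x : ℝ => egfClosedForm x - ∑ n ∈ Finset.range N,
      ((PowerSeries.coeff n egf * x ^ n : ℝ) : ℂ)) =O[𝓝 0] fun x : ℝ => x ^ N := by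
  -- the expansion to order `N + 2` exceeds the one to order `N` by two terms
  -- that are `O(x^N)`
  have hmono : ∀ k, (fun x : ℝ => x ^ (N + k)) =O[𝓝 0] fun x : ℝ => x ^ N := fun k => by
    refine IsBigO.of_bound 1 ?_
    filter_upwards [eventually_abs_le] with x hx
    rw [norm_pow, norm_pow, Real.norm_eq_abs, one_mul]
    exact pow_le_pow_of_le_one (abs_nonneg x) (by linarith) (by lia)
  have hterm : ∀ k, (fun x : ℝ => ((PowerSeries.coeff (N + k) egf * x ^ (N + k) : ℝ) : ℂ))
      =O[𝓝 0] fun x : ℝ => x ^ N := fun k => by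
    refine IsBigO.trans ?_ (hmono k)
    refine IsBigO.of_bound |PowerSeries.coeff (N + k) egf| (Eventually.of_forall fun x => ?_)
    rw [Complex.norm_real, norm_mul, Real.norm_eq_abs]
  have h := (((egfClosedForm_sub_isBigO_add_two N).trans (hmono 2)).add (hterm 1)).add (hterm 0)
  refine h.congr_left fun x => ?_
  rw [Finset.sum_range_succ, Finset.sum_range_succ]
  simp only [add_zero]
  ring

end ClosedForm

end TernaryMenage

end

theorem mainTheorem3 :
    -- the integral formula for the individual numbers
    (∀ n : ℕ, 1 < n →
      IntegrableOn (fun t : ℝ => (TernaryMenage.coeffSeries t).coeff (n : ℤ) * Real.exp (-t))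
        (Ioi 0) ∧
      (TernaryMenage.T n : ℝ) = (n.factorial : ℝ) *
        ∫ t in Ioi (0 : ℝ), (TernaryMenage.coeffSeries t).coeff (n : ℤ) * Real.exp (-t)) ∧
    -- the generating function as a formal power series, integrated coefficient by coefficient
    (∀ n : ℕ,
      IntegrableOn (fun t : ℝ => (TernaryMenage.egfSeries t).coeff (n : ℤ) * Real.exp (-t))
        (Ioi 0) ∧
      PowerSeries.coeff n TernaryMenage.egf =
        PowerSeries.coeff n (-2 + 2 * PowerSeries.X : PowerSeries ℝ) +
        ∫ t in Ioi (0 : ℝ), (TernaryMenage.egfSeries t).coeff (n : ℤ) * Real.exp (-t)) ∧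
    -- the closed form: its principal values exist near `0`
    (∀ᶠ x : ℝ in 𝓝 0,
      TernaryMenage.HasPV (Ioi 0) (fun t : ℝ => Real.exp (-t) / (x + 2 - t)) (x + 2)
        (Real.exp (-x - 2) * TernaryMenage.Ei (x + 2)) ∧
      TernaryMenage.HasPV (Ioi 0) (TernaryMenage.egfIntegrand x) (x + 2)
        (TernaryMenage.pv (Ioi 0) (TernaryMenage.egfIntegrand x) (x + 2))) ∧
    -- and the generating function is its expansion at `0`, to every order
    (∀ N : ℕ,
      (fun x : ℝ => TernaryMenage.egfClosedForm x -
        ∑ n ∈ Finset.range N,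
          ((PowerSeries.coeff n TernaryMenage.egf * x ^ n : ℝ) : ℂ))
        =O[𝓝 0] fun x : ℝ => x ^ N) := by
  exact ⟨TernaryMenage.T_integral_formula, TernaryMenage.egf_integral_formula,
    TernaryMenage.hasPV_eventually, TernaryMenage.egfClosedForm_sub_isBigO⟩
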